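/- Let $\mathbb{P}^1$ be the complex projective line with affine coordinate $z$, and let $h_X$ be a continuous Hermitian metric on $T\mathbb{P}^1$, with normalized Kähler form $\omega_0=\frac{i}{2\pi}h_X\bigl(\frac{\partial}{\partial z},\frac{\partial}{\partial z}\bigr)\,dz\wedge d\bar z$. Let $E=\mathcal{O}(m)$, $m\in\mathbb{Z}$ (every holomorphic line bundle on $\mathbb{P}^1$ is of this form), and let $1$ denote its standard holomorphic frame $x_0^m$ over the chart $\mathbb{C}$ with coordinate $z$; holomorphic sections are identified on this chart with their coefficient in the frame $1$. A Hermitian metric of class $C^\infty$ on a line bundle is positive if $c_1=dd^c(-\log h(s,s))\ge 0$ for local holomorphic frames $s$. A continuous Hermitian metric is admissible if it is the uniform limit of positive metrics of class $C^\infty$ (that is, the quotients of the metrics converge uniformly to $1$ on $\mathbb{P}^1$). Let $h_\infty$ be an admissible metric on $E$ that is invariant under the action of $S^1$. Let $\overline{A^{0,0}(\mathbb{P}^1,E)}_\infty$ be the completion of the space $A^{0,0}(\mathbb{P}^1,E)$ of smooth sections for the norm $\|s\|_{L^2,\infty}^2=\int_{\mathbb{P}^1}h_\infty(s,s)\,\omega_0$.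 For a metric $h$ of class $C^\infty$ on $E$ let $\Delta_{E,h}=\bar\partial_E^*\bar\partial_E$ be the generalized Laplacian; in the frame $1$, $$\Delta_{E,h}(s)=-h_X\Bigl(\tfrac{\partial}{\partial z},\tfrac{\partial}{\partial z}\Bigr)^{-1}h(1,1)^{-1}\frac{\partial}{\partial z}\Bigl(h(1,1)\frac{\partial s}{\partial\bar z}\Bigr).$$ The limit Laplacian $\Delta_{E,\infty}$ is the operator on $A^{0,0}(\mathbb{P}^1,E)$ that is characterized as follows: for every decomposition $(E,h_\infty)=(E_1,h_{1,\infty})\otimes(E_2,h_{2,\infty})^{-1}$ into admissible line bundles and all sequences $(h_{i,n})_n$ of positive metrics of class $C^\infty$ on $E_i$ converging uniformly to $h_{i,\infty}$ ($i=1,2$), with $h_n=h_{1,n}\otimes h_{2,n}^{-1}$, one has $\Delta_{E,h_n}\xi\to\Delta_{E,\infty}\xi$ in $L^2_\infty$ for every $\xi\in A^{0,0}(\mathbb{P}^1,E)$. Put $\mathcal{C}_\infty(u)=\log h_\infty(1,1)(e^{-u})$ for $u\in\mathbb{R}$. Then $\mathcal{C}_\infty$ is concave on $\mathbb{R}$,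 so that it has a finite right derivative $\mathcal{C}_{d,\infty}'$ everywhere. For $f\in A^{0,0}(\mathbb{P}^1)$ and $\sigma\in H^0(\mathbb{P}^1,E)$ define on $\mathbb{C}$ $$\Delta'_{E,\infty}(f\otimes\sigma)(z)=-h_X\Bigl(\tfrac{\partial}{\partial z},\tfrac{\partial}{\partial z}\Bigr)^{-1}\frac{\partial^2f}{\partial z\,\partial\bar z}\,\sigma-h_X\Bigl(\tfrac{\partial}{\partial z},\tfrac{\partial}{\partial z}\Bigr)^{-1}\Bigl(\frac{\partial\sigma}{\partial z}-\frac{\bar z}{2|z|^2}\,\mathcal{C}_{d,\infty}'(-\log|z|)\,\sigma\Bigr)\frac{\partial f}{\partial\bar z}$$ for $z\ne0$, and by the same formula without the term in $\mathcal{C}_{d,\infty}'$ for $z=0$. Then: 1. $\|\Delta'_{E,\infty}(f\otimes\sigma)\|_{L^2,\infty}<\infty$ for all $f\in A^{0,0}(\mathbb{P}^1)$ and $\sigma\in H^0(\mathbb{P}^1,E)$, and there is a unique linear operator $\Delta'_{E,\infty}:A^{0,0}(\mathbb{P}^1,E)\to\overline{A^{0,0}(\mathbb{P}^1,E)}_\infty$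 whose value on each $f\otimes\sigma$ is (almost everywhere) given by this formula. 2. The limit Laplacian $\Delta_{E,\infty}:A^{0,0}(\mathbb{P}^1,E)\to\overline{A^{0,0}(\mathbb{P}^1,E)}_\infty$ exists, is unique, and $\Delta'_{E,\infty}=\Delta_{E,\infty}$. -/

import Mathlib

open MeasureTheory Filter Topology Set
open scoped ContDiff ENNReal ComplexConjugate

noncomputable section

namespace P1

/-!
The complex projective line is glued from two copies of `ℂ`, with coordinates `z` and `w`,
along `w = 1 / z` on `z ≠ 0`.  The line bundle `O(m)` has the holomorphic frame `e₀ = x₀ ^ m`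
(the section written `1`) on the `z`-chart and the frame `e₁ = x₁ ^ m` on the `w`-chart, with
`e₁ = z ^ m • e₀` on the overlap.
-/

/-- The Wirtinger derivative `∂f/∂z`. -/
def dz (f : ℂ → ℂ) (z : ℂ) : ℂ :=
  (1 / 2) * (fderiv ℝ f z 1 - Complex.I * fderiv ℝ f z Complex.I)

/-- The Wirtinger derivative `∂f/∂z̄`. -/
def dzbar (f : ℂ → ℂ) (z : ℂ) : ℂ :=
  (1 / 2) * (fderiv ℝ f z 1 + Complex.I * fderiv ℝ f z Complex.I)

/-- The space `A^{0,0}(P¹, O(m))` of smooth global sections of `O(m)`.  A section is the pair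
`(s₀, s₁)` of its coefficients in the two frames, `s = s₀ e₀ = s₁ e₁`.  For `m = 0` this is the
space `A^{0,0}(P¹)` of smooth complex functions. -/
def SmoothSection (m : ℤ) : Submodule ℂ ((ℂ → ℂ) × (ℂ → ℂ)) where
  carrier := {s | ContDiff ℝ ∞ s.1 ∧ ContDiff ℝ ∞ s.2 ∧ ∀ z : ℂ, z ≠ 0 → s.1 z = z ^ m * s.2 z⁻¹}
  zero_mem' := ⟨contDiff_const, contDiff_const, fun z _ => by simp⟩
  add_mem' := by
    rintro s t ⟨hs₀, hs₁, hs⟩ ⟨ht₀, ht₁, ht⟩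
    refine ⟨hs₀.add ht₀, hs₁.add ht₁, fun z hz => ?_⟩
    simp only [Prod.fst_add, Prod.snd_add, Pi.add_apply, hs z hz, ht z hz]
    ring
  smul_mem' := by
    rintro c s ⟨hs₀, hs₁, hs⟩
    refine ⟨contDiff_const.mul hs₀, contDiff_const.mul hs₁, fun z hz => ?_⟩
    simp only [Prod.smul_fst, Prod.smul_snd, Pi.smul_apply, smul_eq_mul, hs z hz]
    ring

/-- The space `H⁰(P¹, O(m))` of holomorphic global sections of `O(m)`. -/
def HolomorphicSection (m : ℤ) : Submodule ℂ ((ℂ → ℂ) × (ℂ → ℂ)) where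
  carrier := {s | Differentiable ℂ s.1 ∧ Differentiable ℂ s.2 ∧
    ∀ z : ℂ, z ≠ 0 → s.1 z = z ^ m * s.2 z⁻¹}
  zero_mem' := ⟨differentiable_const 0, differentiable_const 0, fun z _ => by simp⟩
  add_mem' := by
    rintro s t ⟨hs₀, hs₁, hs⟩ ⟨ht₀, ht₁, ht⟩
    refine ⟨hs₀.add ht₀, hs₁.add ht₁, fun z hz => ?_⟩
    simp only [Prod.fst_add, Prod.snd_add, Pi.add_apply, hs z hz, ht z hz]
    ring
  smul_mem' := by
    rintro c s ⟨hs₀, hs₁, hs⟩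
    refine ⟨hs₀.const_smul c, hs₁.const_smul c, fun z hz => ?_⟩
    simp only [Prod.smul_fst, Prod.smul_snd, Pi.smul_apply, smul_eq_mul, hs z hz]
    ring

/-- The smooth section `f ⊗ σ`, for a smooth function `f` and a holomorphic section `σ`. -/
def tensor {m : ℤ} (f : SmoothSection 0) (σ : HolomorphicSection m) : SmoothSection m :=
  ⟨(fun z => f.1.1 z * σ.1.1 z, fun w => f.1.2 w * σ.1.2 w), by
    obtain ⟨⟨f₀, f₁⟩, hf₀, hf₁, hf⟩ := f
    obtain ⟨⟨s₀, s₁⟩, hs₀, hs₁, hs⟩ := σ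
    refine ⟨hf₀.mul ((hs₀.contDiff (n := ∞)).restrict_scalars ℝ),
      hf₁.mul ((hs₁.contDiff (n := ∞)).restrict_scalars ℝ), fun z hz => ?_⟩
    have h1 := hf z hz
    have h2 := hs z hz
    simp only [zpow_zero, one_mul] at h1 h2 ⊢
    rw [h1, h2]
    ring⟩

/-- A continuous Hermitian metric `h` on `O(m)`, given by `h(e₀, e₀)` and `h(e₁, e₁)`.
The tangent bundle of `P¹` is `O(2)`, with frames `∂/∂z` and `-∂/∂w = z ^ 2 • ∂/∂z`, so a
Hermitian metric on `TP¹` is an element of `HermitianMetric 2`, whose component `chart₀` is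
the function `h(∂/∂z, ∂/∂z)`. -/
structure HermitianMetric (m : ℤ) where
  chart₀ : ℂ → ℝ
  chart₁ : ℂ → ℝ
  continuous₀ : Continuous chart₀
  continuous₁ : Continuous chart₁
  pos₀ : ∀ z, 0 < chart₀ z
  pos₁ : ∀ w, 0 < chart₁ w
  glue : ∀ z : ℂ, z ≠ 0 → chart₁ z⁻¹ = ‖z‖ ^ (2 * m) * chart₀ z

namespace HermitianMetric

/-- The metric is of class `C^∞`. -/
def IsSmooth {m : ℤ} (h : HermitianMetric m) : Prop :=
  ContDiff ℝ ∞ h.chart₀ ∧ ContDiff ℝ ∞ h.chart₁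

/-- A smooth metric is positive if `c₁ = dd^c (-log h(e, e)) ≥ 0` for each of the two frames `e`;
`dd^c φ` is a positive multiple of `i ∂²φ/∂z∂z̄ dz ∧ dz̄`. -/
def IsPositive {m : ℤ} (h : HermitianMetric m) : Prop :=
  (∀ z, 0 ≤ (dz (dzbar fun ζ => ((-Real.log (h.chart₀ ζ) : ℝ) : ℂ)) z).re) ∧
    ∀ w, 0 ≤ (dz (dzbar fun ζ => ((-Real.log (h.chart₁ ζ) : ℝ) : ℂ)) w).re

/-- Uniform convergence of metrics: the functions `hₙ / h` on `P¹` converge uniformly to `1`. -/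
def ConvergesUniformly {m : ℤ} (hn : ℕ → HermitianMetric m) (h : HermitianMetric m) : Prop :=
  TendstoUniformly (fun n z => (hn n).chart₀ z / h.chart₀ z) (fun _ => 1) atTop ∧
    TendstoUniformly (fun n w => (hn n).chart₁ w / h.chart₁ w) (fun _ => 1) atTop

/-- `hn` is a sequence of smooth positive metrics that converges uniformly to `h`. -/
def IsPositiveApproximation {m : ℤ} (hn : ℕ → HermitianMetric m) (h : HermitianMetric m) : Prop :=
  (∀ n, (hn n).IsSmooth ∧ (hn n).IsPositive) ∧ ConvergesUniformly hn h

/-- A metric is admissible if it is a uniform limit of smooth positive metrics. -/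
def IsAdmissible {m : ℤ} (h : HermitianMetric m) : Prop :=
  ∃ hn : ℕ → HermitianMetric m, IsPositiveApproximation hn h

/-- `(O(m), h) = (O(m₁), h₁) ⊗ (O(m₂), h₂)⁻¹` as Hermitian line bundles. -/
def IsQuotient {m m₁ m₂ : ℤ} (h : HermitianMetric m) (h₁ : HermitianMetric m₁)
    (h₂ : HermitianMetric m₂) : Prop :=
  m = m₁ - m₂ ∧ (∀ z, h.chart₀ z = h₁.chart₀ z / h₂.chart₀ z) ∧
    ∀ w, h.chart₁ w = h₁.chart₁ w / h₂.chart₁ w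

/-- Invariance of the metric under the action of the circle `S¹` on `P¹` and `O(m)`. -/
def IsCircleInvariant {m : ℤ} (h : HermitianMetric m) : Prop :=
  ∀ (ζ : Circle) (z : ℂ), h.chart₀ (ζ * z) = h.chart₀ z

/-- The function `C(u) = log h(1, 1)(e^{-u})` on `ℝ`. -/
def logRadial {m : ℤ} (h : HermitianMetric m) (u : ℝ) : ℝ :=
  Real.log (h.chart₀ ((Real.exp (-u) : ℝ) : ℂ))

/-- The right derivative of `C(u) = log h(1, 1)(e^{-u})`. -/
def logRadialRightDeriv {m : ℤ} (h : HermitianMetric m) (u : ℝ) : ℝ :=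
  derivWithin h.logRadial (Ioi u) u

end HermitianMetric

/-- The measure `h(1, 1) ω₀` on the `z`-chart, where
`ω₀ = (i / 2π) h_X(∂/∂z, ∂/∂z) dz ∧ dz̄ = (1 / π) h_X(∂/∂z, ∂/∂z) dx dy` is the normalized
Kähler form of `h_X`.  The complement of the `z`-chart is one point, which has measure zero. -/
def weight {m : ℤ} (hX : HermitianMetric 2) (h : HermitianMetric m) : Measure ℂ :=
  (volume : Measure ℂ).withDensity
    fun z => ENNReal.ofReal (hX.chart₀ z * h.chart₀ z / Real.pi)

/-- The Hilbert space of square integrable sections of `O(m)` (modulo null sets) with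
`‖s‖² = ∫ h(s, s) ω₀`; a section is given by its coefficient in the frame `e₀`. -/
abbrev L2 {m : ℤ} (hX : HermitianMetric 2) (h : HermitianMetric m) : Type :=
  Lp ℂ 2 (weight hX h)

/-- Smooth sections are square integrable. -/
theorem memLp_smoothSection {m : ℤ} (hX : HermitianMetric 2) (h : HermitianMetric m)
    (s : SmoothSection m) : MemLp s.1.1 2 (weight hX h) := by
  obtain ⟨⟨s₀, s₁⟩, hs₀, hs₁, hs⟩ := s
  dsimp only at hs₀ hs₁ hs ⊢
  have hw : Continuous fun z => hX.chart₀ z * h.chart₀ z / Real.pi :=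
    (hX.continuous₀.mul h.continuous₀).div_const _
  rw [memLp_two_iff_integrable_sq_norm hs₀.continuous.aestronglyMeasurable, weight,
    integrable_withDensity_iff hw.measurable.ennreal_ofReal (by simp)]
  have hF₀ : Continuous fun z => ‖s₀ z‖ ^ 2 * (hX.chart₀ z * h.chart₀ z / Real.pi) :=
    (hs₀.continuous.norm.pow 2).mul hw
  have hF₁ : Continuous fun z => ‖s₁ z‖ ^ 2 * (hX.chart₁ z * h.chart₁ z / Real.pi) :=
    (hs₁.continuous.norm.pow 2).mul ((hX.continuous₁.mul h.continuous₁).div_const _)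
  obtain ⟨A, hA⟩ := (isCompact_closedBall (0 : ℂ) 1).exists_bound_of_continuousOn hF₀.continuousOn
  obtain ⟨B, hB⟩ := (isCompact_closedBall (0 : ℂ) 1).exists_bound_of_continuousOn hF₁.continuousOn
  have hA0 : 0 ≤ A := (norm_nonneg _).trans (hA 0 (by simp))
  have hB0 : 0 ≤ B := (norm_nonneg _).trans (hB 0 (by simp))
  have key : ∀ z, ‖s₀ z‖ ^ 2 * (hX.chart₀ z * h.chart₀ z / Real.pi) ≤
      (16 * (A + B)) * (1 + ‖z‖) ^ (-(4 : ℝ)) := by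
    intro z
    have hz0 := norm_nonneg z
    have hpos : (0 : ℝ) < (1 + ‖z‖) ^ 4 := by positivity
    have hr : (1 + ‖z‖) ^ (-(4 : ℝ)) = ((1 + ‖z‖) ^ 4)⁻¹ := by
      rw [Real.rpow_neg (by positivity)]
      norm_cast
    rw [hr, ← div_eq_mul_inv, le_div_iff₀ hpos]
    rcases le_total ‖z‖ 1 with h1 | h1
    · have e1 := (le_abs_self _).trans (hA z (by simpa using h1))
      have e2 : (1 + ‖z‖) ^ 4 ≤ 16 := by
        calc (1 + ‖z‖) ^ 4 ≤ (1 + 1) ^ 4 := by gcongr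
          _ = 16 := by norm_num
      calc _ ≤ A * 16 := mul_le_mul e1 e2 hpos.le hA0
        _ ≤ _ := by linarith
    · have hzn : 0 < ‖z‖ := by linarith
      have hz : z ≠ 0 := norm_pos_iff.mp hzn
      have hb := hB z⁻¹ (by simpa using inv_le_one_of_one_le₀ h1)
      have e1 := (le_abs_self _).trans hb
      have e3 : ‖s₀ z‖ ^ 2 * (hX.chart₀ z * h.chart₀ z / Real.pi) * ‖z‖ ^ 4 =
          ‖s₁ z⁻¹‖ ^ 2 * (hX.chart₁ z⁻¹ * h.chart₁ z⁻¹ / Real.pi) := by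
        have e4 : ‖z‖ ^ (2 * m) = (‖z‖ ^ m) ^ 2 := by
          rw [mul_comm, zpow_mul]
          norm_cast
        have e5 : ‖z‖ ^ (2 * (2 : ℤ)) = ‖z‖ ^ 4 := by norm_cast
        rw [hs z hz, hX.glue z hz, h.glue z hz, norm_mul, norm_zpow, e4, e5]
        ring
      have e2 : (1 + ‖z‖) ^ 4 ≤ 16 * ‖z‖ ^ 4 := by
        calc (1 + ‖z‖) ^ 4 ≤ (2 * ‖z‖) ^ 4 := by gcongr; linarith
          _ = 16 * ‖z‖ ^ 4 := by ring
      have hn : 0 ≤ ‖s₀ z‖ ^ 2 * (hX.chart₀ z * h.chart₀ z / Real.pi) := by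
        have := hX.pos₀ z
        have := h.pos₀ z
        positivity
      calc _ ≤ ‖s₀ z‖ ^ 2 * (hX.chart₀ z * h.chart₀ z / Real.pi) * (16 * ‖z‖ ^ 4) :=
            mul_le_mul_of_nonneg_left e2 hn
        _ ≤ 16 * B := by rw [← e3] at e1; linarith
        _ ≤ _ := by linarith
  refine Integrable.mono' ((integrable_one_add_norm (μ := (volume : Measure ℂ)) (r := 4)
    (by simp [Complex.finrank_real_complex]; norm_num)).const_mul (16 * (A + B))) ?_
    (Eventually.of_forall fun z => ?_)
  · exact ((hs₀.continuous.norm.pow 2).measurable.mul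
      hw.measurable.ennreal_ofReal.ennreal_toReal).aestronglyMeasurable
  · have hp : 0 ≤ hX.chart₀ z * h.chart₀ z / Real.pi := by
      have := hX.pos₀ z
      have := h.pos₀ z
      positivity
    rw [ENNReal.toReal_ofReal hp, Real.norm_of_nonneg (by positivity)]
    exact key z

/-- The map from smooth sections to their classes in `L2`. -/
def toL2 {m : ℤ} (hX : HermitianMetric 2) (h : HermitianMetric m) :
    SmoothSection m →ₗ[ℂ] L2 hX h where
  toFun s := (memLp_smoothSection hX h s).toLp _
  map_add' _ _ := rfl
  map_smul' _ _ := rfl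

/-- The completion of `A^{0,0}(P¹, O(m))` for the `L²` norm induced by `h_X` and `h`, realized
as the closure of the smooth sections in the Hilbert space `L2`. -/
abbrev L2Completion {m : ℤ} (hX : HermitianMetric 2) (h : HermitianMetric m) :
    Submodule ℂ (L2 hX h) :=
  (LinearMap.range (toL2 hX h)).topologicalClosure

/-- The operator `∂̄` on sections: the coefficient of `∂̄ (s e₀)` in the frame `dz̄ ⊗ e₀`. -/
def dbar (s : ℂ → ℂ) : ℂ → ℂ :=
  dzbar s

/-- The formal adjoint `∂̄* = - * ∂̄ *` of `∂̄`: the coefficient in the frame `e₀` of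
`∂̄* (g dz̄ ⊗ e₀) = - h_X(∂/∂z, ∂/∂z)⁻¹ h(e₀, e₀)⁻¹ ∂/∂z (h(e₀, e₀) g) e₀`. -/
def dbarAdjoint {m : ℤ} (hX : HermitianMetric 2) (h : HermitianMetric m) (g : ℂ → ℂ) (z : ℂ) : ℂ :=
  -((hX.chart₀ z : ℂ)⁻¹ * (h.chart₀ z : ℂ)⁻¹ * dz (fun ζ => (h.chart₀ ζ : ℂ) * g ζ) z)

/-- The generalized Laplacian `∂̄* ∂̄` of a (smooth) metric `h` on `O(m)`, applied to a smooth
section; the value is given by its coefficient in the frame `e₀`. -/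
def laplacian {m : ℤ} (hX : HermitianMetric 2) (h : HermitianMetric m) (s : SmoothSection m) :
    ℂ → ℂ :=
  dbarAdjoint hX h (dbar s.1.1)

/-- `D` is the limit Laplacian of the metric `h`: for every decomposition
`(O(m), h) = (O(m₁), h₁) ⊗ (O(m₂), h₂)⁻¹`, all sequences of smooth positive metrics `h₁ₙ → h₁` and
`h₂ₙ → h₂` converging uniformly, and every smooth section `ξ`, the Laplacians of the metrics
`hₙ = h₁ₙ ⊗ h₂ₙ⁻¹` applied to `ξ` converge to `D ξ` in the `L²` norm of `h`. -/
def IsLimitLaplacian {m : ℤ} (hX : HermitianMetric 2) (h : HermitianMetric m)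
    (D : SmoothSection m → L2Completion hX h) : Prop :=
  ∀ (m₁ m₂ : ℤ) (h₁ : HermitianMetric m₁) (h₂ : HermitianMetric m₂)
    (h₁n : ℕ → HermitianMetric m₁) (h₂n : ℕ → HermitianMetric m₂) (hn : ℕ → HermitianMetric m),
    h.IsQuotient h₁ h₂ → HermitianMetric.IsPositiveApproximation h₁n h₁ →
    HermitianMetric.IsPositiveApproximation h₂n h₂ → (∀ n, (hn n).IsQuotient (h₁n n) (h₂n n)) →
    ∀ ξ : SmoothSection m,
      Tendsto (fun n => eLpNorm (fun z => laplacian hX (hn n) ξ z - (D ξ : L2 hX h) z) 2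
        (weight hX h)) atTop (𝓝 0)

/-- The expression for `∂/∂z log h(1, 1)` through the right derivative of
`C(u) = log h(1, 1)(e^{-u})`, for a metric invariant under the circle; it is set to `0` at `0`. -/
def radialLogDeriv {m : ℤ} (h : HermitianMetric m) (z : ℂ) : ℂ :=
  if z = 0 then 0
  else -(conj z / (2 * (‖z‖ : ℂ) ^ 2)) * (h.logRadialRightDeriv (-Real.log ‖z‖) : ℂ)

/-- The operator `Δ'` on `f ⊗ σ`, as coefficient in the frame `e₀`:
`-h_X(∂/∂z, ∂/∂z)⁻¹ (∂²f/∂z∂z̄ σ + (∂σ/∂z + (∂/∂z log h(1, 1)) σ) ∂f/∂z̄)`, where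
`∂/∂z log h(1, 1)` is replaced by `radialLogDeriv`.  The product of the logarithmic derivative
of `σ` with `σ` is `∂σ/∂z`. -/
def directLaplacian {m : ℤ} (hX : HermitianMetric 2) (h : HermitianMetric m)
    (f : SmoothSection 0) (σ : HolomorphicSection m) (z : ℂ) : ℂ :=
  -((hX.chart₀ z : ℂ)⁻¹ * (dz (dzbar f.1.1) z * σ.1.1 z)) -
    (hX.chart₀ z : ℂ)⁻¹ *
      ((deriv σ.1.1 z + radialLogDeriv h z * σ.1.1 z) * dzbar f.1.1 z)

/-- `D` is a linear operator on smooth sections, with values in the completion, whose value on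
each `f ⊗ σ` is given by the local formula `directLaplacian`. -/
def IsDirectLaplacian {m : ℤ} (hX : HermitianMetric 2) (h : HermitianMetric m)
    (D : SmoothSection m →ₗ[ℂ] L2Completion hX h) : Prop :=
  ∀ (f : SmoothSection 0) (σ : HolomorphicSection m),
    ((D (tensor f σ) : L2 hX h) : ℂ → ℂ) =ᵐ[weight hX h] directLaplacian hX h f σ

end P1

end

/-! In the frame `1` the product rule turns the Laplacian of a smooth metric into `-h_X⁻¹ (∂∂̄s + (∂
log h) ∂̄s)` (`dbarAdjoint_eq`). The metric enters only through its logarithmic derivative `dzLog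
h`, so the theorem reduces to local `L²` convergence of `dzLog` along uniformly convergent positive
metrics, and to the identification of the limit.

Convergence is an energy estimate (`integral_bump_mul_norm_dz_sq_le`). For `φ`, `ψ` with `∂∂̄φ, ∂∂̄ψ
≥ 0` and `u = φ - ψ`, one has `|∂u|² = ½ ∂∂̄(u²) - u ∂∂̄u`. If `|u| ≤ ε`, then `-u ∂∂̄u ≤ ε (∂∂̄φ +
∂∂̄ψ)`; against a cut-off, all second derivatives move to the cut-off and the integral of `|∂u|²` is
`O(ε)`. So `dzLog hₙ` is Cauchy in `L²` of a disc, and its limit is the weak derivative of `log h`.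

Identification uses the circle action. `log h` is `C(-log|z|)`, and `C` is concave, because `-C(Re
z)` is a uniform limit of `2πi`-periodic subharmonic functions (`concaveOn_logRadial`). Hence `log
h` is locally Lipschitz off the origin, its weak derivative is its pointwise derivative almost
everywhere (`ae_eq_dzLog_of_weak`), and at each point of differentiability off the origin the latter
is the expression in the right derivative of `C` (`radialLogDeriv_eq_dz`). The origin is harmless,
since the limit is an `L²` function and a point is a null set.

The neighbourhood of infinity is the other chart: `laplacianWith_eq_swap` carries the operator
across, and two discs control the `L²` norm (`eLpNorm_weight_le`). Uniqueness of the operator given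
on `f ⊗ σ` holds because concavity of `C` forces `m ≥ 0` (`degree_nonneg`), and then every smooth
section is a sum of two such tensors (`exists_eq_tensor_add_tensor`). -/

noncomputable section

namespace P1

/-! ### Wirtinger calculus -/

/-- The real-linear map `v ↦ a v + b v̄`. -/
def wirtingerMap (a b : ℂ) : ℂ →L[ℝ] ℂ :=
  a • ContinuousLinearMap.id ℝ ℂ + b • (Complex.conjCLE : ℂ →L[ℝ] ℂ)

theorem wirtingerMap_apply (a b v : ℂ) : wirtingerMap a b v = a * v + b * conj v := by
  simp [wirtingerMap]

/-- `f` is real differentiable at `z` with Wirtinger derivatives `a` and `b`. -/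
def HasWirtingerDerivAt (f : ℂ → ℂ) (a b z : ℂ) : Prop :=
  HasFDerivAt f (wirtingerMap a b) z

theorem continuousLinearMap_eq_wirtingerMap (L : ℂ →L[ℝ] ℂ) :
    L = wirtingerMap ((1 / 2) * (L 1 - Complex.I * L Complex.I))
      ((1 / 2) * (L 1 + Complex.I * L Complex.I)) := by
  ext v
  have hv : L v = v.re * L 1 + v.im * L Complex.I := by
    have h1 : v = v.re • (1 : ℂ) + v.im • Complex.I := by
      apply Complex.ext <;> simp
    conv_lhs => rw [h1]
    rw [map_add, map_smul, map_smul]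
    simp
  rw [hv, wirtingerMap_apply]
  have h1 : v = v.re + v.im * Complex.I := (Complex.re_add_im v).symm
  have h2 : conj v = v.re - v.im * Complex.I := by
    apply Complex.ext <;> simp
  rw [h2]
  conv_rhs => rw [h1]
  simp only [Complex.add_re, Complex.ofReal_re, Complex.mul_re, Complex.I_re, mul_zero,
    Complex.ofReal_im, Complex.I_im, mul_one, sub_self, add_zero, Complex.add_im, Complex.mul_im,
    zero_add]
  linear_combination (v.im * L Complex.I) * Complex.I_sq

namespace HasWirtingerDerivAt

variable {f g : ℂ → ℂ} {a b c d z : ℂ}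

theorem dz_eq (h : HasWirtingerDerivAt f a b z) : dz f z = a := by
  rw [dz, HasFDerivAt.fderiv h, wirtingerMap_apply, wirtingerMap_apply, map_one, Complex.conj_I]
  linear_combination (1 / 2 : ℂ) * (b - a) * Complex.I_sq

theorem dzbar_eq (h : HasWirtingerDerivAt f a b z) : dzbar f z = b := by
  rw [dzbar, HasFDerivAt.fderiv h, wirtingerMap_apply, wirtingerMap_apply, map_one, Complex.conj_I]
  linear_combination (1 / 2 : ℂ) * (a - b) * Complex.I_sq

theorem congr_of_eventuallyEq (h : HasWirtingerDerivAt f a b z) (hg : g =ᶠ[𝓝 z] f) :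
    HasWirtingerDerivAt g a b z :=
  HasFDerivAt.congr_of_eventuallyEq h hg

theorem add (hf : HasWirtingerDerivAt f a b z) (hg : HasWirtingerDerivAt g c d z) :
    HasWirtingerDerivAt (fun x => f x + g x) (a + c) (b + d) z := by
  refine (HasFDerivAt.add hf hg).congr_fderiv ?_
  ext v
  simp only [add_apply, wirtingerMap_apply]
  ring

theorem sub (hf : HasWirtingerDerivAt f a b z) (hg : HasWirtingerDerivAt g c d z) :
    HasWirtingerDerivAt (fun x => f x - g x) (a - c) (b - d) z := by
  refine (HasFDerivAt.sub hf hg).congr_fderiv ?_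
  ext v
  simp only [sub_apply, wirtingerMap_apply]
  ring

theorem mul (hf : HasWirtingerDerivAt f a b z) (hg : HasWirtingerDerivAt g c d z) :
    HasWirtingerDerivAt (fun x => f x * g x) (a * g z + f z * c) (b * g z + f z * d) z := by
  refine (HasFDerivAt.mul hf hg).congr_fderiv ?_
  ext v
  simp only [add_apply, smul_apply, wirtingerMap_apply,
    smul_eq_mul]
  ring

theorem const_mul (k : ℂ) (hf : HasWirtingerDerivAt f a b z) :
    HasWirtingerDerivAt (fun x => k * f x) (k * a) (k * b) z := by
  refine (HasFDerivAt.const_mul hf k).congr_fderiv ?_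
  ext v
  simp only [smul_apply, wirtingerMap_apply, smul_eq_mul]
  ring

theorem conj_comp (hf : HasWirtingerDerivAt f a b z) :
    HasWirtingerDerivAt (fun x => conj (f x)) (conj b) (conj a) z := by
  refine ((Complex.conjCLE.hasFDerivAt (x := f z)).comp z hf).congr_fderiv ?_
  ext v
  simp [wirtingerMap_apply]
  ring

theorem comp_hasDerivAt {k : ℂ → ℂ} (hf : HasWirtingerDerivAt f a b (k z))
    (hk : HasDerivAt k c z) :
    HasWirtingerDerivAt (fun x => f (k x)) (a * c) (b * conj c) z := by
  refine (HasFDerivAt.comp z hf (hk.hasFDerivAt.restrictScalars ℝ)).congr_fderiv ?_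
  ext v
  simp [wirtingerMap_apply]
  ring

end HasWirtingerDerivAt

/-- Links `dz` and `dzbar`, defined through `fderiv`, to the product and chain rules for
`HasWirtingerDerivAt`: a real-linear map of `ℂ` is determined by its values at `1` and `I`. -/
theorem hasWirtingerDerivAt_of_differentiableAt {f : ℂ → ℂ} {z : ℂ}
    (h : DifferentiableAt ℝ f z) : HasWirtingerDerivAt f (dz f z) (dzbar f z) z := by
  rw [HasWirtingerDerivAt, dz, dzbar, ← continuousLinearMap_eq_wirtingerMap]
  exact h.hasFDerivAt

theorem HasDerivAt.hasWirtingerDerivAt {f : ℂ → ℂ} {a z : ℂ} (h : HasDerivAt f a z) :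
    HasWirtingerDerivAt f a 0 z := by
  refine (h.hasFDerivAt.restrictScalars ℝ).congr_fderiv ?_
  ext v
  simp [wirtingerMap_apply, mul_comm]

theorem hasWirtingerDerivAt_inv {f : ℂ → ℂ} {a b z : ℂ} (hz : z ≠ 0)
    (h : HasWirtingerDerivAt f a b z⁻¹) :
    HasWirtingerDerivAt (fun x => f x⁻¹) (-(z ^ 2)⁻¹ * a) (-(conj z ^ 2)⁻¹ * b) z := by
  have := h.comp_hasDerivAt (k := fun x => x⁻¹) (hasDerivAt_inv hz)
  convert this using 1
  · ring
  · simp [mul_comm]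

theorem differentiableAt_ofReal_comp_iff {f : ℂ → ℝ} {z : ℂ} :
    DifferentiableAt ℝ (fun x => (f x : ℂ)) z ↔ DifferentiableAt ℝ f z :=
  ⟨fun h => (Complex.reCLM.hasFDerivAt.comp z h.hasFDerivAt).differentiableAt,
    fun h => (Complex.ofRealCLM.hasFDerivAt.comp z h.hasFDerivAt).differentiableAt⟩

theorem fderiv_ofReal {f : ℂ → ℝ} {z : ℂ} (h : DifferentiableAt ℝ f z) (v : ℂ) :
    fderiv ℝ (fun x => (f x : ℂ)) z v = (fderiv ℝ f z v : ℂ) := by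
  have h1 : HasFDerivAt (fun x => (f x : ℂ)) (Complex.ofRealCLM.comp (fderiv ℝ f z)) z :=
    Complex.ofRealCLM.hasFDerivAt.comp z h.hasFDerivAt
  rw [h1.fderiv]
  simp

theorem dz_ofReal {f : ℂ → ℝ} {z : ℂ} (h : DifferentiableAt ℝ f z) :
    dz (fun x => (f x : ℂ)) z =
      (1 / 2) * ((fderiv ℝ f z 1 : ℂ) - Complex.I * (fderiv ℝ f z Complex.I : ℂ)) := by
  rw [dz, fderiv_ofReal h, fderiv_ofReal h]

theorem dzbar_ofReal {f : ℂ → ℝ} {z : ℂ} (h : DifferentiableAt ℝ f z) :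
    dzbar (fun x => (f x : ℂ)) z = conj (dz (fun x => (f x : ℂ)) z) := by
  rw [dz_ofReal h, dzbar, fderiv_ofReal h, fderiv_ofReal h]
  simp [Complex.conj_ofNat]

theorem hasWirtingerDerivAt_log_norm {z : ℂ} (hz : z ≠ 0) :
    HasWirtingerDerivAt (fun x => ((Real.log ‖x‖ : ℝ) : ℂ)) (2 * z)⁻¹ (2 * conj z)⁻¹ z := by
  have h0 : ‖z‖ ^ 2 ≠ 0 := by simpa using hz
  -- `log ‖x‖` is treated as half of `log (‖x‖ ^ 2)`, where the squared norm has an explicit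
  -- differential.
  have h1 : HasFDerivAt (fun x : ℂ => Real.log (‖x‖ ^ 2)) ((‖z‖ ^ 2)⁻¹ • (2 • innerSL ℝ z)) z :=
    (hasStrictFDerivAt_norm_sq z).hasFDerivAt.log h0
  have h2 : HasFDerivAt (fun x : ℂ => (((1 / 2 : ℝ) * Real.log (‖x‖ ^ 2) : ℝ) : ℂ)) _ z :=
    (Complex.ofRealCLM.hasFDerivAt).comp z (h1.const_mul (1 / 2))
  refine (h2.congr_fderiv ?_).congr_of_eventuallyEq (Eventually.of_forall fun x => ?_)
  · have hc : conj z ≠ 0 := by simpa using hz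
    have h3 : ((‖z‖ ^ 2 : ℝ) : ℂ) = z * conj z := by
      rw [Complex.mul_conj, Complex.normSq_eq_norm_sq]
    have key : ∀ v : ℂ, ((inner ℝ z v : ℝ) : ℂ) = (1 / 2) * (conj z * v + z * conj v) := by
      intro v
      apply Complex.ext <;> simp [Complex.inner] <;> ring
    ext v
    have := key v
    simp only [ContinuousLinearMap.comp_apply, smul_apply, innerSL_apply_apply,
      Complex.ofRealCLM_apply, wirtingerMap_apply, smul_eq_mul, nsmul_eq_mul, Complex.ofReal_mul,
      Complex.ofReal_inv, h3, this]
    push_cast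
    field_simp
  · simp [Real.log_pow]

/-! ### Smoothness, supports and integration by parts -/

theorem contDiff_fderiv_apply {f : ℂ → ℂ} (hf : ContDiff ℝ ∞ f) (v : ℂ) :
    ContDiff ℝ ∞ fun z => fderiv ℝ f z v :=
  (hf.fderiv_right (m := ∞) (by simp)).clm_apply contDiff_const

theorem contDiff_dz {f : ℂ → ℂ} (hf : ContDiff ℝ ∞ f) : ContDiff ℝ ∞ (dz f) :=
  contDiff_const.mul ((contDiff_fderiv_apply hf _).sub
    (contDiff_const.mul (contDiff_fderiv_apply hf _)))

theorem contDiff_dzbar {f : ℂ → ℂ} (hf : ContDiff ℝ ∞ f) : ContDiff ℝ ∞ (dzbar f) :=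
  contDiff_const.mul ((contDiff_fderiv_apply hf _).add
    (contDiff_const.mul (contDiff_fderiv_apply hf _)))

theorem contDiff_ofReal_comp {f : ℂ → ℝ} (hf : ContDiff ℝ ∞ f) :
    ContDiff ℝ ∞ fun z => (f z : ℂ) :=
  Complex.ofRealCLM.contDiff.comp hf

theorem dz_eq_zero_of_notMem_tsupport {f : ℂ → ℂ} {z : ℂ} (hz : z ∉ tsupport f) : dz f z = 0 := by
  have : fderiv ℝ f z = 0 := by
    by_contra h
    exact hz (support_fderiv_subset ℝ h)
  simp [dz, this]

theorem dzbar_eq_zero_of_notMem_tsupport {f : ℂ → ℂ} {z : ℂ} (hz : z ∉ tsupport f) :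
    dzbar f z = 0 := by
  have : fderiv ℝ f z = 0 := by
    by_contra h
    exact hz (support_fderiv_subset ℝ h)
  simp [dzbar, this]

theorem tsupport_dz_subset (f : ℂ → ℂ) : tsupport (dz f) ⊆ tsupport f :=
  closure_minimal (fun _ hz => by_contra fun h => hz (dz_eq_zero_of_notMem_tsupport h))
    (isClosed_tsupport f)

theorem hasCompactSupport_dz {f : ℂ → ℂ} (hf : HasCompactSupport f) : HasCompactSupport (dz f) :=
  HasCompactSupport.intro hf fun _ hz => dz_eq_zero_of_notMem_tsupport hz

theorem integral_fderiv_mul_of_hasCompactSupport {f g : ℂ → ℂ} (hf : ContDiff ℝ ∞ f)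
    (hg : ContDiff ℝ ∞ g) (hc : HasCompactSupport g) (v : ℂ) :
    ∫ z, fderiv ℝ f z v * g z = -∫ z, f z * fderiv ℝ g z v := by
  have hg' : HasCompactSupport fun z => fderiv ℝ g z v := hc.fderiv_apply (𝕜 := ℝ) v
  rw [integral_mul_fderiv_eq_neg_fderiv_mul_of_integrable, neg_neg]
  · exact ((contDiff_fderiv_apply hf v).continuous.mul
      hg.continuous).integrable_of_hasCompactSupport hc.mul_left
  · exact (hf.continuous.mul
      (contDiff_fderiv_apply hg v).continuous).integrable_of_hasCompactSupport hg'.mul_left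
  · exact (hf.continuous.mul hg.continuous).integrable_of_hasCompactSupport hc.mul_left
  · exact fun z _ => hf.differentiable (by simp) z
  · exact fun z _ => hg.differentiable (by simp) z

/-- The values `k = -I` and `k = I` give integration by parts for `dz` and for `dzbar` at once. -/
theorem integral_fderiv_combination_mul {f g : ℂ → ℂ} (hf : ContDiff ℝ ∞ f)
    (hg : ContDiff ℝ ∞ g) (hc : HasCompactSupport g) (k : ℂ) :
    ∫ z, (1 / 2) * (fderiv ℝ f z 1 + k * fderiv ℝ f z Complex.I) * g z =
      -∫ z, f z * ((1 / 2) * (fderiv ℝ g z 1 + k * fderiv ℝ g z Complex.I)) := by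
  have hI : ∀ v, Integrable fun z => fderiv ℝ f z v * g z := fun v =>
    ((contDiff_fderiv_apply hf v).continuous.mul hg.continuous).integrable_of_hasCompactSupport
      hc.mul_left
  have hJ : ∀ v, Integrable fun z => f z * fderiv ℝ g z v := fun v =>
    (hf.continuous.mul (contDiff_fderiv_apply hg v).continuous).integrable_of_hasCompactSupport
      (hc.fderiv_apply (𝕜 := ℝ) v).mul_left
  have e1 : ∀ z, (1 / 2) * (fderiv ℝ f z 1 + k * fderiv ℝ f z Complex.I) * g z =
      (1 / 2) * (fderiv ℝ f z 1 * g z) + (k / 2) * (fderiv ℝ f z Complex.I * g z) :=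
    fun z => by ring
  have e2 : ∀ z, f z * ((1 / 2) * (fderiv ℝ g z 1 + k * fderiv ℝ g z Complex.I)) =
      (1 / 2) * (f z * fderiv ℝ g z 1) + (k / 2) * (f z * fderiv ℝ g z Complex.I) :=
    fun z => by ring
  simp_rw [e1, e2]
  rw [integral_add ((hI _).const_mul _) ((hI _).const_mul _),
    integral_add ((hJ _).const_mul _) ((hJ _).const_mul _), integral_const_mul, integral_const_mul,
    integral_const_mul, integral_const_mul, integral_fderiv_mul_of_hasCompactSupport hf hg hc,
    integral_fderiv_mul_of_hasCompactSupport hf hg hc]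
  ring

theorem integral_dz_mul {f g : ℂ → ℂ} (hf : ContDiff ℝ ∞ f) (hg : ContDiff ℝ ∞ g)
    (hc : HasCompactSupport g) : ∫ z, dz f z * g z = -∫ z, f z * dz g z := by
  have := integral_fderiv_combination_mul hf hg hc (-Complex.I)
  simpa only [dz, neg_mul, ← sub_eq_add_neg] using this

theorem integral_dzbar_mul {f g : ℂ → ℂ} (hf : ContDiff ℝ ∞ f) (hg : ContDiff ℝ ∞ g)
    (hc : HasCompactSupport g) : ∫ z, dzbar f z * g z = -∫ z, f z * dzbar g z :=
  integral_fderiv_combination_mul hf hg hc Complex.I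

/-! ### The energy estimate for differences of subharmonic functions -/

/-- The operator `∂²/∂z∂z̄` on a real function (a quarter of the Laplacian). -/
def dzdzbar (f : ℂ → ℝ) (z : ℂ) : ℝ :=
  (dz (dzbar fun x => (f x : ℂ)) z).re

theorem continuous_dzdzbar {f : ℂ → ℝ} (hf : ContDiff ℝ ∞ f) : Continuous (dzdzbar f) :=
  Complex.continuous_re.comp (contDiff_dz (contDiff_dzbar (contDiff_ofReal_comp hf))).continuous

/-- The formal adjoint of `dzdzbar`. -/
def dzbardz (f : ℂ → ℝ) (z : ℂ) : ℝ :=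
  (dzbar (dz fun x => (f x : ℂ)) z).re

theorem continuous_dzbardz {f : ℂ → ℝ} (hf : ContDiff ℝ ∞ f) : Continuous (dzbardz f) :=
  Complex.continuous_re.comp (contDiff_dzbar (contDiff_dz (contDiff_ofReal_comp hf))).continuous

theorem tsupport_ofReal_comp (f : ℂ → ℝ) : tsupport (fun x => (f x : ℂ)) = tsupport f := by
  simp [tsupport, Function.support]

theorem dzbardz_eq_zero_of_notMem_tsupport {f : ℂ → ℝ} {z : ℂ} (hz : z ∉ tsupport f) :
    dzbardz f z = 0 := by
  rw [dzbardz, dzbar_eq_zero_of_notMem_tsupport, Complex.zero_re]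
  exact fun h => hz (tsupport_ofReal_comp f ▸ tsupport_dz_subset _ h)

theorem hasCompactSupport_dzbardz {f : ℂ → ℝ} (hf : HasCompactSupport f) :
    HasCompactSupport (dzbardz f) :=
  HasCompactSupport.intro hf fun _ hz => dzbardz_eq_zero_of_notMem_tsupport hz

/-- Two integrations by parts reverse the order of the derivatives, which is why the adjoint is
`dzbardz`; symmetry of second derivatives is not needed. -/
theorem integral_dzdzbar_mul {f χ : ℂ → ℝ} (hf : ContDiff ℝ ∞ f) (hχ : ContDiff ℝ ∞ χ)
    (hc : HasCompactSupport χ) : ∫ z, dzdzbar f z * χ z = ∫ z, f z * dzbardz χ z := by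
  have hf' := contDiff_ofReal_comp hf
  have hχ' := contDiff_ofReal_comp hχ
  have hc' : HasCompactSupport fun x => (χ x : ℂ) := hc.comp_left (g := fun x : ℝ => (x : ℂ)) rfl
  have h1 := integral_dz_mul (contDiff_dzbar hf') hχ' hc'
  have h2 := integral_dzbar_mul hf' (contDiff_dz hχ') (hasCompactSupport_dz hc')
  rw [h2, neg_neg] at h1
  have i1 : Integrable fun z => dz (dzbar fun x => (f x : ℂ)) z * (χ z : ℂ) :=
    ((contDiff_dz (contDiff_dzbar hf')).continuous.mul
      hχ'.continuous).integrable_of_hasCompactSupport hc'.mul_left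
  have i2 : Integrable fun z => (f z : ℂ) * dzbar (dz fun x => (χ x : ℂ)) z :=
    (hf'.continuous.mul
      (contDiff_dzbar (contDiff_dz hχ')).continuous).integrable_of_hasCompactSupport
      (HasCompactSupport.mul_left (HasCompactSupport.intro hc' fun _ hz =>
        dzbar_eq_zero_of_notMem_tsupport fun h => hz (tsupport_dz_subset _ h)))
  have e1 : ∀ z, dzdzbar f z * χ z =
      Complex.reCLM (dz (dzbar fun x => (f x : ℂ)) z * (χ z : ℂ)) := fun z => by
    simp [dzdzbar]
  have e2 : ∀ z, f z * dzbardz χ z =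
      Complex.reCLM ((f z : ℂ) * dzbar (dz fun x => (χ x : ℂ)) z) := fun z => by
    simp [dzbardz]
  simp_rw [e1, e2]
  rw [ContinuousLinearMap.integral_comp_comm _ i1, ContinuousLinearMap.integral_comp_comm _ i2, h1]

theorem dzdzbar_sub {f g : ℂ → ℝ} (hf : ContDiff ℝ ∞ f) (hg : ContDiff ℝ ∞ g) (z : ℂ) :
    dzdzbar (fun x => f x - g x) z = dzdzbar f z - dzdzbar g z := by
  have hf' := contDiff_ofReal_comp hf
  have hg' := contDiff_ofReal_comp hg
  have e : dzbar (fun x => ((f x - g x : ℝ) : ℂ)) =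
      fun x => dzbar (fun x => (f x : ℂ)) x - dzbar (fun x => (g x : ℂ)) x := by
    funext x
    simp only [Complex.ofReal_sub]
    exact ((hasWirtingerDerivAt_of_differentiableAt (hf'.differentiable (by simp) x)).sub
      (hasWirtingerDerivAt_of_differentiableAt (hg'.differentiable (by simp) x))).dzbar_eq
  rw [dzdzbar, e, ((hasWirtingerDerivAt_of_differentiableAt
    ((contDiff_dzbar hf').differentiable (by simp) z)).sub
      (hasWirtingerDerivAt_of_differentiableAt
        ((contDiff_dzbar hg').differentiable (by simp) z))).dz_eq]
  simp [dzdzbar]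

/-- For real `f` the two first derivatives are conjugate, so their product is `|∂f|²`. This
expresses the gradient through quantities that can be integrated by parts. -/
theorem dzdzbar_sq {f : ℂ → ℝ} (hf : ContDiff ℝ ∞ f) (z : ℂ) :
    dzdzbar (fun x => f x ^ 2) z =
      2 * ‖dz (fun x => (f x : ℂ)) z‖ ^ 2 + 2 * f z * dzdzbar f z := by
  have hf' := contDiff_ofReal_comp hf
  have hd : ∀ x, HasWirtingerDerivAt (fun x => (f x : ℂ)) _ _ x := fun x =>
    hasWirtingerDerivAt_of_differentiableAt (hf'.differentiable (by simp) x)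
  have e : dzbar (fun x => ((f x ^ 2 : ℝ) : ℂ)) =
      fun x => 2 * ((f x : ℂ) * dzbar (fun x => (f x : ℂ)) x) := by
    funext x
    simp only [sq, Complex.ofReal_mul]
    rw [((hd x).mul (hd x)).dzbar_eq]
    ring
  rw [dzdzbar, e, (((hd z).mul (hasWirtingerDerivAt_of_differentiableAt
    ((contDiff_dzbar hf').differentiable (by simp) z))).const_mul 2).dz_eq,
    dzbar_ofReal (hf.differentiable (by simp) z), Complex.mul_conj, Complex.normSq_eq_norm_sq]
  simp only [dzdzbar, Complex.add_re, Complex.mul_re, Complex.ofReal_re, Complex.ofReal_im,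
    Complex.re_ofNat, Complex.im_ofNat, Complex.add_im, Complex.mul_im]
  ring

/-- Write `|∂u|² = ½ ∂∂̄(u²) - u ∂∂̄u` for `u = φ - ψ`. The first term contributes `ε² / 2` after
both derivatives move to `χ`. In the second, positivity bounds `-u ∂∂̄u` by `ε (∂∂̄φ + ∂∂̄ψ)`, and
each summand integrates against `χ` to at most `M ∫ |dzbardz χ|`. No bound on the second derivatives
of `φ` or `ψ` enters. -/
theorem integral_bump_mul_norm_dz_sq_le {φ ψ χ : ℂ → ℝ} (hφ : ContDiff ℝ ∞ φ)
    (hψ : ContDiff ℝ ∞ ψ) (hχ : ContDiff ℝ ∞ χ) (hc : HasCompactSupport χ) (hχ0 : ∀ z, 0 ≤ χ z)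
    (hφ0 : ∀ z, 0 ≤ dzdzbar φ z) (hψ0 : ∀ z, 0 ≤ dzdzbar ψ z) {M ε : ℝ}
    (hφM : ∀ z ∈ tsupport χ, |φ z| ≤ M) (hψM : ∀ z ∈ tsupport χ, |ψ z| ≤ M)
    (hε : ∀ z ∈ tsupport χ, |φ z - ψ z| ≤ ε) (hε0 : 0 ≤ ε) :
    ∫ z, χ z * ‖dz (fun x => ((φ x - ψ x : ℝ) : ℂ)) z‖ ^ 2 ≤
      (ε ^ 2 / 2 + 2 * M * ε) * ∫ z, |dzbardz χ z| := by
  set u : ℂ → ℝ := fun x => φ x - ψ x with hu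
  have hus : ContDiff ℝ ∞ u := hφ.sub hψ
  have hu2 : ContDiff ℝ ∞ fun x => u x ^ 2 := hus.pow 2
  have hB := continuous_dzbardz hχ
  have hBc := hasCompactSupport_dzbardz hc
  have i1 : Integrable fun z => dzdzbar (fun x => u x ^ 2) z * χ z :=
    ((continuous_dzdzbar hu2).mul hχ.continuous).integrable_of_hasCompactSupport hc.mul_left
  have i2 : Integrable fun z => dzdzbar φ z * χ z :=
    ((continuous_dzdzbar hφ).mul hχ.continuous).integrable_of_hasCompactSupport hc.mul_left
  have i3 : Integrable fun z => dzdzbar ψ z * χ z :=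
    ((continuous_dzdzbar hψ).mul hχ.continuous).integrable_of_hasCompactSupport hc.mul_left
  have iB : Integrable fun z => |dzbardz χ z| :=
    hB.abs.integrable_of_hasCompactSupport (hBc.comp_left abs_zero)
  have hle : ∀ z, χ z * ‖dz (fun x => (u x : ℂ)) z‖ ^ 2 ≤
      (1 / 2) * (dzdzbar (fun x => u x ^ 2) z * χ z) +
        ε * (dzdzbar φ z * χ z + dzdzbar ψ z * χ z) := by
    intro z
    have hu' : χ z * (-(u z * (dzdzbar φ z - dzdzbar ψ z))) ≤
        χ z * (ε * (dzdzbar φ z + dzdzbar ψ z)) := by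
      by_cases hz : z ∈ tsupport χ
      · refine mul_le_mul_of_nonneg_left ?_ (hχ0 z)
        obtain ⟨h1, h2⟩ := abs_le.mp (hε z hz)
        have h3 := hφ0 z
        have h4 := hψ0 z
        change -ε ≤ u z at h1
        change u z ≤ ε at h2
        nlinarith
      · simp [image_eq_zero_of_notMem_tsupport hz]
    rw [dzdzbar_sq hus, show dzdzbar u z = _ from dzdzbar_sub hφ hψ z]
    linarith
  have h1 : ∫ z, dzdzbar (fun x => u x ^ 2) z * χ z ≤ ε ^ 2 * ∫ z, |dzbardz χ z| := by
    rw [integral_dzdzbar_mul hu2 hχ hc, ← integral_const_mul]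
    refine integral_mono ((hu2.continuous.mul hB).integrable_of_hasCompactSupport hBc.mul_left)
      (iB.const_mul _) fun z => ?_
    by_cases hz : z ∈ tsupport χ
    · have h3 : u z ^ 2 ≤ ε ^ 2 := sq_le_sq' (abs_le.mp (hε z hz)).1 (abs_le.mp (hε z hz)).2
      calc u z ^ 2 * dzbardz χ z ≤ u z ^ 2 * |dzbardz χ z| :=
            mul_le_mul_of_nonneg_left (le_abs_self _) (sq_nonneg _)
        _ ≤ _ := mul_le_mul_of_nonneg_right h3 (abs_nonneg _)
    · simp [dzbardz_eq_zero_of_notMem_tsupport hz]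
  have h2 : ∀ f : ℂ → ℝ, ContDiff ℝ ∞ f → (∀ z ∈ tsupport χ, |f z| ≤ M) →
      ∫ z, dzdzbar f z * χ z ≤ M * ∫ z, |dzbardz χ z| := by
    intro f hf hfM
    rw [integral_dzdzbar_mul hf hχ hc, ← integral_const_mul]
    refine integral_mono ((hf.continuous.mul hB).integrable_of_hasCompactSupport hBc.mul_left)
      (iB.const_mul _) fun z => ?_
    by_cases hz : z ∈ tsupport χ
    · calc f z * dzbardz χ z ≤ |f z| * |dzbardz χ z| := by
            rw [← abs_mul]; exact le_abs_self _
        _ ≤ _ := mul_le_mul_of_nonneg_right (hfM z hz) (abs_nonneg _)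
    · simp [dzbardz_eq_zero_of_notMem_tsupport hz]
  have i0 : Integrable fun z => χ z * ‖dz (fun x => (u x : ℂ)) z‖ ^ 2 :=
    (hχ.continuous.mul ((contDiff_dz
      (contDiff_ofReal_comp hus)).continuous.norm.pow 2)).integrable_of_hasCompactSupport
      hc.mul_right
  have i23 : Integrable fun z => dzdzbar φ z * χ z + dzdzbar ψ z * χ z := i2.add i3
  calc _ ≤ ∫ z, (1 / 2) * (dzdzbar (fun x => u x ^ 2) z * χ z) +
        ε * (dzdzbar φ z * χ z + dzdzbar ψ z * χ z) :=
        integral_mono i0 ((i1.const_mul _).add (i23.const_mul _)) hle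
    _ = (1 / 2) * (∫ z, dzdzbar (fun x => u x ^ 2) z * χ z) +
        ε * ((∫ z, dzdzbar φ z * χ z) + ∫ z, dzdzbar ψ z * χ z) := by
      rw [integral_add (i1.const_mul _) (i23.const_mul _), integral_const_mul,
        integral_const_mul, integral_add i2 i3]
    _ ≤ _ := by
      have := h2 φ hφ hφM
      have := h2 ψ hψ hψM
      nlinarith

/-! ### Maximum principle and convexity -/

theorem dzdzbar_eq_quarter_laplacian {f : ℂ → ℝ} (hf : ContDiff ℝ ∞ f) (z : ℂ) :
    dzdzbar f z = (1 / 4) * (fderiv ℝ (fun x => fderiv ℝ f x 1) z 1 +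
      fderiv ℝ (fun x => fderiv ℝ f x Complex.I) z Complex.I) := by
  have hd : ∀ v, Differentiable ℝ fun x => fderiv ℝ f x v := fun v =>
    ((hf.fderiv_right (m := ∞) (by simp)).clm_apply contDiff_const).differentiable (by simp)
  have e : dzbar (fun x => (f x : ℂ)) = fun x => (1 / 2) * (((fderiv ℝ f x 1 : ℝ) : ℂ) +
      Complex.I * ((fderiv ℝ f x Complex.I : ℝ) : ℂ)) := by
    funext x
    rw [dzbar, fderiv_ofReal (hf.differentiable (by simp) x),
      fderiv_ofReal (hf.differentiable (by simp) x)]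
  have hw : ∀ v, HasWirtingerDerivAt (fun x => ((fderiv ℝ f x v : ℝ) : ℂ)) _ _ z := fun v =>
    hasWirtingerDerivAt_of_differentiableAt (differentiableAt_ofReal_comp_iff.mpr (hd v z))
  rw [dzdzbar, e, (((hw 1).add ((hw Complex.I).const_mul Complex.I)).const_mul (1 / 2)).dz_eq,
    dz_ofReal (hd 1 z), dz_ofReal (hd Complex.I z)]
  simp
  ring

/-- The Laplacian is the sum of the second derivatives along `1` and `I`, so one of them is
positive. On that line the second derivative test gives a local minimum; together with a local
maximum the function is locally constant there, and the second derivative would vanish. -/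
theorem not_isLocalMax_of_dzdzbar_pos {f : ℂ → ℝ} (hf : ContDiff ℝ ∞ f) {z : ℂ}
    (hz : 0 < dzdzbar f z) : ¬ IsLocalMax f z := by
  intro hmax
  obtain ⟨v, hv⟩ : ∃ v, 0 < fderiv ℝ (fun x => fderiv ℝ f x v) z v := by
    by_contra! H
    have h1 := H 1
    have h2 := H Complex.I
    rw [dzdzbar_eq_quarter_laplacian hf] at hz
    linarith
  have hl : ∀ t : ℝ, HasDerivAt (fun t : ℝ => z + t • v) v t := fun t => by
    simpa using ((hasDerivAt_id t).smul_const v).const_add z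
  have hg : ∀ t : ℝ, HasDerivAt (fun t : ℝ => f (z + t • v)) (fderiv ℝ f (z + t • v) v) t :=
    fun t => ((hf.differentiable (by simp) (z + t • v)).hasFDerivAt).comp_hasDerivAt t (hl t)
  have hd : Differentiable ℝ fun x => fderiv ℝ f x v :=
    ((hf.fderiv_right (m := ∞) (by simp)).clm_apply contDiff_const).differentiable (by simp)
  have hg' : deriv (fun t : ℝ => f (z + t • v)) = fun t => fderiv ℝ f (z + t • v) v :=
    funext fun t => (hg t).deriv
  have hg2 : deriv (deriv fun t : ℝ => f (z + t • v)) 0 =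
      fderiv ℝ (fun x => fderiv ℝ f x v) z v := by
    rw [hg']
    have := ((hd (z + (0 : ℝ) • v)).hasFDerivAt).comp_hasDerivAt (0 : ℝ) (hl 0)
    simpa [Function.comp_def] using this.deriv
  have hc : Tendsto (fun t : ℝ => z + t • v) (𝓝 0) (𝓝 z) := by
    simpa using (hl 0).continuousAt.tendsto
  have hmax' : IsLocalMax (fun t : ℝ => f (z + t • v)) 0 := by
    filter_upwards [hc.eventually hmax] with t ht
    simpa using ht
  have hmin := isLocalMin_of_deriv_deriv_pos (by rw [hg2]; exact hv) hmax'.deriv_eq_zero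
    (hg 0).continuousAt
  have hconst : (fun t : ℝ => f (z + t • v)) =ᶠ[𝓝 0] fun _ => f (z + (0 : ℝ) • v) := by
    filter_upwards [hmax', hmin] with t h1 h2 using le_antisymm h1 h2
  rw [hconst.deriv.deriv_eq] at hg2
  simp at hg2
  linarith

/-- The linear tilt is harmonic, while the quadratic term makes a subharmonic function strictly so,
as the maximum principle requires. -/
theorem dzdzbar_add_quadratic_re {F : ℂ → ℝ} (hF : ContDiff ℝ ∞ F) (s ε : ℝ) (z : ℂ) :
    dzdzbar (fun x => F x + (ε * x.re ^ 2 - s * x.re)) z = dzdzbar F z + ε / 2 := by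
  have hre : ContDiff ℝ ∞ fun x : ℂ => x.re := Complex.reCLM.contDiff
  have hq : ContDiff ℝ ∞ fun x : ℂ => ε * x.re ^ 2 - s * x.re :=
    (contDiff_const.mul (hre.pow 2)).sub (contDiff_const.mul hre)
  have hr : ∀ x : ℂ, HasFDerivAt (fun x : ℂ => x.re) Complex.reCLM x :=
    fun x => Complex.reCLM.hasFDerivAt
  have hq' : ∀ x v : ℂ, fderiv ℝ (fun x : ℂ => ε * x.re ^ 2 - s * x.re) x v =
      (2 * ε * x.re - s) * v.re := fun x v => by
    have h1 : HasFDerivAt (fun x : ℂ => ε * x.re ^ 2 - s * x.re) _ x :=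
      (((hr x).pow 2).const_mul ε).sub ((hr x).const_mul s)
    rw [h1.fderiv]
    simp
    ring
  have hs : ∀ x v : ℂ, fderiv ℝ (fun x => F x + (ε * x.re ^ 2 - s * x.re)) x v =
      fderiv ℝ F x v + (2 * ε * x.re - s) * v.re := fun x v => by
    rw [fderiv_fun_add (hF.differentiable (by simp) x) (hq.differentiable (by simp) x),
      add_apply, hq']
  have hd : ∀ v, Differentiable ℝ fun x => fderiv ℝ F x v := fun v =>
    ((hF.fderiv_right (m := ∞) (by simp)).clm_apply contDiff_const).differentiable (by simp)
  have ht : ∀ v : ℂ, fderiv ℝ (fun x => fderiv ℝ F x v + (2 * ε * x.re - s) * v.re) z v =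
      fderiv ℝ (fun x => fderiv ℝ F x v) z v + 2 * ε * v.re * v.re := fun v => by
    have h1 : HasFDerivAt (fun x => fderiv ℝ F x v + (2 * ε * x.re - s) * v.re) _ z :=
      (hd v z).hasFDerivAt.add ((((hr z).const_mul (2 * ε)).sub_const s).mul_const v.re)
    rw [h1.fderiv]
    simp
    ring
  rw [dzdzbar_eq_quarter_laplacian (hF.add hq), dzdzbar_eq_quarter_laplacian hF]
  simp_rw [hs]
  rw [ht, ht]
  simp
  ring

/-- A uniform limit of `2πi`-periodic smooth subharmonic functions which depends only on the real
part is convex. -/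
theorem convexOn_of_periodic_subharmonic_approx {P : ℝ → ℝ}
    (hP : ∀ δ > 0, ∃ F : ℂ → ℝ, ContDiff ℝ ∞ F ∧ (∀ z, 0 ≤ dzdzbar F z) ∧
      (∀ z, F (z + 2 * Real.pi * Complex.I) = F z) ∧ ∀ z, |F z - P z.re| ≤ δ) :
    ConvexOn ℝ univ P := by
  -- `s` is the slope of the chord over `[x₁, x₂]`; the claim is that `P` lies below this chord.
  have key : ∀ x₁ x₂ x s : ℝ, x₁ < x₂ → x ∈ Icc x₁ x₂ → P x₁ - s * x₁ = P x₂ - s * x₂ →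
      P x ≤ P x₁ - s * x₁ + s * x := by
    intro x₁ x₂ x s h12 hx hs
    refine le_of_forall_pos_le_add fun η hη => ?_
    -- Error budget `η`: the approximation costs `η / 4` at `x` and again at the maximum point, and
    -- the quadratic term costs at most `ε * N = η / 2`.
    set N : ℝ := x₁ ^ 2 + x₂ ^ 2 + 1 with hN
    have hN0 : 0 < N := by positivity
    obtain ⟨F, hF, hF0, hper, hFP⟩ := hP (η / 4) (by positivity)
    set ε : ℝ := η / (2 * N) with hεd
    have hε : 0 < ε := by positivity
    have hεN : ε * N = η / 2 := by rw [hεd]; field_simp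
    set f : ℂ → ℝ := fun x => F x + (ε * x.re ^ 2 - s * x.re) with hfd
    have hre : ContDiff ℝ ∞ fun x : ℂ => x.re := Complex.reCLM.contDiff
    have hf : ContDiff ℝ ∞ f :=
      hF.add ((contDiff_const.mul (hre.pow 2)).sub (contDiff_const.mul hre))
    have hK : IsCompact (Icc x₁ x₂ ×ℂ Icc 0 (2 * Real.pi)) :=
      isCompact_Icc.reProdIm isCompact_Icc
    obtain ⟨p, hp, hpm⟩ := hK.exists_isMaxOn
      ⟨⟨x₁, 0⟩, ⟨⟨le_rfl, h12.le⟩, ⟨le_rfl, by positivity⟩⟩⟩ hf.continuous.continuousOn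
    -- By periodicity the maximum over one compact rectangle is the maximum over the whole strip, so
    -- its horizontal edges do not count as boundary.
    have hperZ : ∀ (k : ℤ) (z : ℂ), f (z + k * (2 * Real.pi * Complex.I)) = f z := by
      have hper' : Function.Periodic F (2 * Real.pi * Complex.I) := hper
      intro k z
      have := hper'.int_mul k z
      simp only [hfd, this]
      simp
    have hpm' : ∀ z : ℂ, z.re ∈ Icc x₁ x₂ → f z ≤ f p := by
      intro z hz
      obtain ⟨k, hk, -⟩ := existsUnique_add_zsmul_mem_Ico Real.two_pi_pos z.im 0
      rw [← hperZ k z]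
      refine hpm ⟨?_, ?_⟩
      · simpa using hz
      · have := Ico_subset_Icc_self hk
        simpa using this
    -- The maximum principle puts the maximum on a vertical edge, and the tilt by `s` makes `P x - s
    -- * x` take the same value on both.
    have hpb : p.re = x₁ ∨ p.re = x₂ := by
      by_contra! H
      have h1 : p.re ∈ Ioo x₁ x₂ :=
        ⟨lt_of_le_of_ne hp.1.1 (Ne.symm H.1), lt_of_le_of_ne hp.1.2 H.2⟩
      refine not_isLocalMax_of_dzdzbar_pos hf (z := p) ?_ ?_
      · rw [dzdzbar_add_quadratic_re hF]
        have := hF0 p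
        linarith
      · filter_upwards [(isOpen_Ioo.preimage Complex.continuous_re).mem_nhds h1] with z hz
        exact hpm' z (Ioo_subset_Icc_self hz)
    have h1 := hpm' x (by simpa using hx)
    have h2 := (abs_le.mp (hFP x)).1
    have h3 := (abs_le.mp (hFP p)).2
    simp only [hfd, Complex.ofReal_re] at h1 h2
    have h4 : 0 ≤ ε * x ^ 2 := by positivity
    have h5 : ε * p.re ^ 2 ≤ ε * N := by
      refine mul_le_mul_of_nonneg_left ?_ hε.le
      rcases hpb with h | h <;> rw [h] <;> nlinarith [sq_nonneg x₁, sq_nonneg x₂]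
    have h6 : P p.re - s * p.re = P x₁ - s * x₁ := by
      rcases hpb with h | h <;> rw [h]
      exact hs.symm
    linarith
  refine LinearOrder.convexOn_of_lt convex_univ fun x _ y _ hxy a b ha hb hab => ?_
  have hyx : y - x ≠ 0 := (sub_pos.mpr hxy).ne'
  have hs : P x - (P y - P x) / (y - x) * x = P y - (P y - P x) / (y - x) * y := by
    field_simp
    ring
  have hb' : b = 1 - a := by linarith
  have := key x y (a • x + b • y) _ hxy (convex_Icc x y ⟨le_rfl, hxy.le⟩ ⟨hxy.le, le_rfl⟩
    ha.le hb.le hab) hs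
  refine this.trans (le_of_eq ?_)
  simp only [smul_eq_mul, hb']
  field_simp
  ring

/-- The substitution is holomorphic, so `∂∂̄` only acquires the squared modulus of its derivative,
and subharmonicity survives. It turns radial functions into functions of the real part. -/
theorem dzdzbar_comp_exp_neg {φ : ℂ → ℝ} (hφ : ContDiff ℝ ∞ φ) (z : ℂ) :
    dzdzbar (fun x => φ (Complex.exp (-x))) z =
      ‖Complex.exp (-z)‖ ^ 2 * dzdzbar φ (Complex.exp (-z)) := by
  have hφ' := contDiff_ofReal_comp hφ
  have hk : ∀ x, HasDerivAt (fun x => Complex.exp (-x)) (-Complex.exp (-x)) x := fun x => by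
    simpa using (hasDerivAt_neg x).cexp
  have e : dzbar (fun x => (φ (Complex.exp (-x)) : ℂ)) = fun x =>
      -1 * (dzbar (fun x => (φ x : ℂ)) (Complex.exp (-x)) * conj (Complex.exp (-x))) := by
    funext x
    rw [((hasWirtingerDerivAt_of_differentiableAt
      (hφ'.differentiable (by simp) _)).comp_hasDerivAt (hk x)).dzbar_eq]
    simp
  have hw := (hasWirtingerDerivAt_of_differentiableAt
    ((contDiff_dzbar hφ').differentiable (by simp) _)).comp_hasDerivAt (hk z)
  rw [dzdzbar, e, ((hw.mul (HasDerivAt.hasWirtingerDerivAt (hk z)).conj_comp).const_mul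
    (-1)).dz_eq, map_zero, mul_zero, add_zero, mul_assoc, neg_mul (Complex.exp (-z)),
    Complex.mul_conj, Complex.normSq_eq_norm_sq, neg_one_mul, mul_neg, neg_neg, mul_comm,
    Complex.re_ofReal_mul, dzdzbar]

/-! ### Metrics: exchange of charts, concavity and regularity of the logarithm -/

namespace HermitianMetric

variable {m : ℤ}

/-- The same metric, with the two charts exchanged. -/
def swap (h : HermitianMetric m) : HermitianMetric m where
  chart₀ := h.chart₁
  chart₁ := h.chart₀
  continuous₀ := h.continuous₁
  continuous₁ := h.continuous₀
  pos₀ := h.pos₁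
  pos₁ := h.pos₀
  glue z hz := by
    have hn : ‖z‖ ≠ 0 := norm_ne_zero_iff.mpr hz
    have := h.glue z⁻¹ (inv_ne_zero hz)
    rw [inv_inv, norm_inv, inv_zpow] at this
    rw [this, mul_inv_cancel_left₀ (zpow_ne_zero _ hn)]

theorem IsPositiveApproximation.swap {hn : ℕ → HermitianMetric m} {h : HermitianMetric m}
    (H : IsPositiveApproximation hn h) : IsPositiveApproximation (fun n => (hn n).swap) h.swap :=
  ⟨fun n => ⟨⟨(H.1 n).1.2, (H.1 n).1.1⟩, (H.1 n).2.2, (H.1 n).2.1⟩, H.2.2, H.2.1⟩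

theorem IsQuotient.swap {m₁ m₂ : ℤ} {h : HermitianMetric m} {h₁ : HermitianMetric m₁}
    {h₂ : HermitianMetric m₂} (H : h.IsQuotient h₁ h₂) : h.swap.IsQuotient h₁.swap h₂.swap :=
  ⟨H.1, H.2.2, H.2.1⟩

theorem IsAdmissible.swap {h : HermitianMetric m} (H : h.IsAdmissible) : h.swap.IsAdmissible :=
  let ⟨hn, H'⟩ := H
  ⟨fun n => (hn n).swap, H'.swap⟩

theorem IsCircleInvariant.swap {h : HermitianMetric m} (H : h.IsCircleInvariant) :
    h.swap.IsCircleInvariant := by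
  intro ζ z
  rcases eq_or_ne z 0 with rfl | hz
  · simp
  · change h.chart₁ _ = h.chart₁ _
    have h1 := h.glue ((ζ⁻¹ : Circle) * z⁻¹ : ℂ) (by simp [hz])
    have h2 := h.glue z⁻¹ (inv_ne_zero hz)
    have h3 := H ζ⁻¹ z⁻¹
    rw [Circle.coe_inv] at h1 h3
    rw [h3] at h1
    rw [inv_inv] at h2
    rw [mul_inv, inv_inv, inv_inv] at h1
    rw [h1, h2, norm_mul, norm_inv, Circle.norm_coe, inv_one, one_mul]

/-- The logarithm of `h(e₀, e₀)`. -/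
def logChart (h : HermitianMetric m) (z : ℂ) : ℝ :=
  Real.log (h.chart₀ z)

theorem continuous_logChart (h : HermitianMetric m) : Continuous h.logChart :=
  h.continuous₀.log fun z => (h.pos₀ z).ne'

theorem IsSmooth.contDiff_logChart {h : HermitianMetric m} (hs : h.IsSmooth) :
    ContDiff ℝ ∞ h.logChart :=
  hs.1.log fun z => (h.pos₀ z).ne'

theorem IsQuotient.logChart_eq {m₁ m₂ : ℤ} {h : HermitianMetric m} {h₁ : HermitianMetric m₁}
    {h₂ : HermitianMetric m₂} (H : h.IsQuotient h₁ h₂) (z : ℂ) :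
    h.logChart z = h₁.logChart z - h₂.logChart z := by
  rw [logChart, H.2.1, Real.log_div (h₁.pos₀ z).ne' (h₂.pos₀ z).ne', logChart, logChart]

theorem logChart_swap_inv (h : HermitianMetric m) {z : ℂ} (hz : z ≠ 0) :
    h.logChart z = h.swap.logChart z⁻¹ - 2 * m * Real.log ‖z‖ := by
  rw [logChart, logChart, show h.swap.chart₀ z⁻¹ = _ from h.glue z hz, Real.log_mul
    (zpow_ne_zero _ (norm_ne_zero_iff.mpr hz)) (h.pos₀ z).ne', Real.log_zpow]
  push_cast
  ring

theorem ConvergesUniformly.eventually_logChart {hn : ℕ → HermitianMetric m}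
    {h : HermitianMetric m} (H : ConvergesUniformly hn h) {δ : ℝ} (hδ : 0 < δ) :
    ∀ᶠ n in atTop, ∀ z, |(hn n).logChart z - h.logChart z| < δ := by
  have hl : ContinuousAt Real.log 1 := Real.continuousAt_log one_ne_zero
  obtain ⟨η, hη, hη'⟩ := Metric.continuousAt_iff.mp hl δ hδ
  filter_upwards [Metric.tendstoUniformly_iff.mp H.1 η hη] with n hn' z
  have := hη' ((dist_comm _ _).trans_lt (hn' z))
  rwa [Real.log_one, Real.log_div ((hn n).pos₀ z).ne' (h.pos₀ z).ne', dist_zero_right] at this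

theorem IsCircleInvariant.chart_eq {h : HermitianMetric m} (H : h.IsCircleInvariant) {z w : ℂ}
    (hz : z ≠ 0) (hzw : ‖w‖ = ‖z‖) : h.chart₀ w = h.chart₀ z := by
  have h1 := H ⟨w / z, by simp [Submonoid.unitSphere, hzw, hz]⟩ z
  rwa [div_mul_cancel₀ _ hz] at h1

theorem IsCircleInvariant.logChart_eq {h : HermitianMetric m} (H : h.IsCircleInvariant) {z : ℂ}
    (hz : z ≠ 0) : h.logChart z = h.logRadial (-Real.log ‖z‖) := by
  rw [logChart, logRadial, neg_neg, Real.exp_log (norm_pos_iff.mpr hz),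
    H.chart_eq (w := (‖z‖ : ℂ)) hz (by simp)]

/-- The functions `-log hₙ(e^{-z})` are subharmonic and `2πi`-periodic, and they approximate `-C(Re
z)` uniformly on the whole plane. The `hₙ` themselves need not be invariant. -/
theorem concaveOn_logRadial {h : HermitianMetric m} (hadm : h.IsAdmissible)
    (hinv : h.IsCircleInvariant) : ConcaveOn ℝ univ h.logRadial := by
  obtain ⟨hn, H⟩ := hadm
  rw [← neg_convexOn_iff]
  refine convexOn_of_periodic_subharmonic_approx fun δ hδ => ?_
  obtain ⟨n, hδn⟩ := (H.2.eventually_logChart hδ).exists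
  have hs : ContDiff ℝ ∞ fun z => -(hn n).logChart z := (H.1 n).1.contDiff_logChart.neg
  refine ⟨fun z => -(hn n).logChart (Complex.exp (-z)), ?_, fun z => ?_, fun z => ?_, fun z => ?_⟩
  · exact hs.comp ((Complex.contDiff_exp (𝕜 := ℝ)).comp contDiff_neg)
  · rw [dzdzbar_comp_exp_neg hs]
    exact mul_nonneg (sq_nonneg _) ((H.1 n).2.1 _)
  · change -(hn n).logChart (Complex.exp (-(z + _))) = _
    rw [neg_add, ← sub_eq_add_neg, Complex.exp_sub, Complex.exp_two_pi_mul_I, div_one]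
  · have h1 := hδn (Complex.exp (-z))
    rw [hinv.logChart_eq (Complex.exp_ne_zero _), Complex.norm_exp, Real.log_exp, Complex.neg_re,
      neg_neg] at h1
    rw [Pi.neg_apply, ← abs_neg, neg_sub_neg, neg_sub]
    exact h1.le

theorem differentiableWithinAt_logRadial {h : HermitianMetric m} (hadm : h.IsAdmissible)
    (hinv : h.IsCircleInvariant) (u : ℝ) : DifferentiableWithinAt ℝ h.logRadial (Ioi u) u := by
  have hc := neg_convexOn_iff.mpr (concaveOn_logRadial hadm hinv)
  have := hc.differentiableWithinAt_Ioi_of_mem_interior (x := u) (by simp)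
  simpa using this.neg

/-- `C(R)` stays bounded as `R → ∞`, while the transition to the other chart gives `C(-R) = O(1) -
2mR`. Concavity at the midpoint of `-R` and `R` then bounds `-2mR` from above for all `R ≥ 0`. -/
theorem degree_nonneg {h : HermitianMetric m} (hadm : h.IsAdmissible)
    (hinv : h.IsCircleInvariant) : 0 ≤ m := by
  have hc := concaveOn_logRadial hadm hinv
  have hb : ∀ k : HermitianMetric m, ∃ A, ∀ z : ℂ, ‖z‖ ≤ 1 → |k.logChart z| ≤ A := fun k => by
    obtain ⟨A, hA⟩ := (isCompact_closedBall (0 : ℂ) 1).exists_bound_of_continuousOn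
      k.continuous_logChart.continuousOn
    exact ⟨A, fun z hz => hA z (by simpa using hz)⟩
  obtain ⟨A, hA⟩ := hb h
  obtain ⟨B, hB⟩ := hb h.swap
  by_contra! hm
  have hm' : (m : ℝ) ≤ -1 := by exact_mod_cast Int.le_sub_one_of_lt hm
  have key : ∀ R : ℝ, 0 ≤ R → 2 * R ≤ 2 * h.logRadial 0 + A + B := by
    intro R hR
    have h1 := hc.2 (mem_univ (-R)) (mem_univ R) (by norm_num : (0 : ℝ) ≤ 1 / 2)
      (by norm_num : (0 : ℝ) ≤ 1 / 2) (by norm_num)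
    have h2 : (1 / 2 : ℝ) • (-R) + (1 / 2 : ℝ) • R = 0 := by simp
    rw [h2, smul_eq_mul, smul_eq_mul] at h1
    have e1 : h.logRadial R = h.logChart ((Real.exp (-R) : ℝ) : ℂ) := rfl
    have e2 : h.logRadial (-R) = h.logChart ((Real.exp R : ℝ) : ℂ) := by
      rw [logRadial, neg_neg, logChart]
    have h3 := (abs_le.mp (hA ((Real.exp (-R) : ℝ) : ℂ) (by
      rw [Complex.norm_real, Real.norm_of_nonneg (Real.exp_pos _).le]
      simpa using hR))).1
    have h4 := (abs_le.mp (hB ((Real.exp R : ℝ) : ℂ)⁻¹ (by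
      rw [norm_inv, Complex.norm_real, Real.norm_of_nonneg (Real.exp_pos _).le, ← Real.exp_neg]
      simpa using hR))).1
    have h5 := h.logChart_swap_inv (z := ((Real.exp R : ℝ) : ℂ))
      (Complex.ofReal_ne_zero.mpr (Real.exp_pos _).ne')
    rw [Complex.norm_real, Real.norm_of_nonneg (Real.exp_pos _).le, Real.log_exp] at h5
    rw [e1, e2] at h1
    nlinarith
  have := key (|2 * h.logRadial 0 + A + B| + 1) (by positivity)
  have := le_abs_self (2 * h.logRadial 0 + A + B)
  have := abs_nonneg (2 * h.logRadial 0 + A + B)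
  linarith

/-- Finite convex functions on `ℝ` are locally Lipschitz, and `-log ‖x‖` is `C¹` off the origin. -/
theorem exists_lipschitzOnWith_logChart {h : HermitianMetric m} (hadm : h.IsAdmissible)
    (hinv : h.IsCircleInvariant) {z : ℂ} (hz : z ≠ 0) :
    ∃ K, ∃ t ∈ 𝓝 z, LipschitzOnWith K h.logChart t := by
  have hl : LocallyLipschitz h.logRadial := by
    have := (neg_convexOn_iff.mpr (concaveOn_logRadial hadm hinv)).locallyLipschitz.neg
    simpa using this
  obtain ⟨K, t, ht, hK⟩ := hl (-Real.log ‖z‖)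
  have hn : ContDiffAt ℝ 1 (fun x : ℂ => -Real.log ‖x‖) z :=
    ((contDiffAt_norm ℝ hz).log (norm_ne_zero_iff.mpr hz)).neg
  obtain ⟨K', t', ht', hK'⟩ := hn.exists_lipschitzOnWith
  have h0 : {x : ℂ | x ≠ 0} ∈ 𝓝 z := isOpen_ne.mem_nhds hz
  refine ⟨K * K', t' ∩ (fun x : ℂ => -Real.log ‖x‖) ⁻¹' t ∩ {x | x ≠ 0},
    inter_mem (inter_mem ht' (hn.continuousAt ht)) h0, ?_⟩
  intro x hx y hy
  rw [hinv.logChart_eq hx.2, hinv.logChart_eq hy.2]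
  exact hK.comp (hK'.mono fun x hx => hx.1.1) (fun x hx => hx.1.2) hx hy

/-- Restriction to the ray through `z` makes `C` differentiable at `-log ‖z‖`, so the right
derivative is the derivative. The chain rule with `∂(-log|z|) = -1/(2z) = -z̄/(2|z|²)` gives the
formula. -/
theorem radialLogDeriv_eq_dz {h : HermitianMetric m} (hinv : h.IsCircleInvariant) {z : ℂ}
    (hz : z ≠ 0) (hd : DifferentiableAt ℝ h.logChart z) :
    radialLogDeriv h z = dz (fun x => (h.logChart x : ℂ)) z := by
  have hn : ‖z‖ ≠ 0 := norm_ne_zero_iff.mpr hz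
  set u₀ : ℝ := -Real.log ‖z‖ with hu₀
  have he : ((Real.exp (-u₀) : ℝ) : ℂ) * (z / ‖z‖) = z := by
    rw [hu₀, neg_neg, Real.exp_log (norm_pos_iff.mpr hz),
      mul_div_cancel₀ _ (Complex.ofReal_ne_zero.mpr hn)]
  have hrad : h.logRadial = fun u => h.logChart (((Real.exp (-u) : ℝ) : ℂ) * (z / ‖z‖)) := by
    funext u
    have h0 : ((Real.exp (-u) : ℝ) : ℂ) * (z / ‖z‖) ≠ 0 :=
      mul_ne_zero (Complex.ofReal_ne_zero.mpr (Real.exp_pos _).ne')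
        (div_ne_zero hz (Complex.ofReal_ne_zero.mpr hn))
    rw [hinv.logChart_eq h0]
    congr 1
    rw [norm_mul, norm_div, Complex.norm_real, Complex.norm_real, norm_norm, div_self hn, mul_one,
      Real.norm_of_nonneg (Real.exp_pos _).le, Real.log_exp, neg_neg]
  have hC : DifferentiableAt ℝ h.logRadial u₀ := by
    rw [hrad]
    have h1 : DifferentiableAt ℝ (fun u : ℝ => ((Real.exp (-u) : ℝ) : ℂ) * (z / ‖z‖)) u₀ := by
      refine DifferentiableAt.mul_const ?_ _
      exact Complex.ofRealCLM.differentiableAt.comp u₀ (by fun_prop)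
    have h2 : DifferentiableAt ℝ h.logChart
      ((fun u : ℝ => ((Real.exp (-u) : ℝ) : ℂ) * (z / ‖z‖)) u₀) := by simpa only [he] using hd
    exact DifferentiableAt.comp (g := h.logChart) u₀ h2 h1
  have hr : h.logRadialRightDeriv u₀ = deriv h.logRadial u₀ :=
    hC.derivWithin (uniqueDiffWithinAt_Ioi u₀)
  have hw : HasWirtingerDerivAt (fun x => (h.logChart x : ℂ))
      ((deriv h.logRadial u₀ : ℝ) * (-(2 * z)⁻¹))
      ((deriv h.logRadial u₀ : ℝ) * (-(2 * conj z)⁻¹)) z := by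
    have h1 : HasFDerivAt (fun x : ℂ => -Real.log ‖x‖) _ z :=
      (((contDiffAt_norm ℝ hz (n := 1)).log hn).neg.differentiableAt (by simp)).hasFDerivAt
    have h2 : HasFDerivAt (fun x : ℂ => h.logRadial (-Real.log ‖x‖)) _ z :=
      HasDerivAt.comp_hasFDerivAt (h₂ := h.logRadial) z hC.hasDerivAt h1
    have h3 : HasFDerivAt (fun x : ℂ => ((h.logRadial (-Real.log ‖x‖) : ℝ) : ℂ)) _ z :=
      Complex.ofRealCLM.hasFDerivAt.comp z h2
    have h4 : HasFDerivAt (fun x : ℂ => ((-Real.log ‖x‖ : ℝ) : ℂ)) _ z :=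
      Complex.ofRealCLM.hasFDerivAt.comp z h1
    have h5 : HasWirtingerDerivAt (fun x : ℂ => ((-Real.log ‖x‖ : ℝ) : ℂ))
        (-(2 * z)⁻¹) (-(2 * conj z)⁻¹) z := by
      simpa using (hasWirtingerDerivAt_log_norm hz).const_mul (-1)
    -- The differential supplied by `h1` is left implicit; uniqueness of derivatives identifies it
    -- with the Wirtinger form.
    have h6 := h4.unique h5
    refine HasWirtingerDerivAt.congr_of_eventuallyEq
      (f := fun x : ℂ => ((h.logRadial (-Real.log ‖x‖) : ℝ) : ℂ)) ?_ ?_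
    · refine h3.congr_fderiv ?_
      ext v
      have h7 := congrArg (fun L : ℂ →L[ℝ] ℂ => L v) h6
      simp only [ContinuousLinearMap.comp_apply, Complex.ofRealCLM_apply, wirtingerMap_apply,
        smul_apply, smul_eq_mul] at h7 ⊢
      rw [Complex.ofReal_mul, h7]
      ring
    · filter_upwards [isOpen_ne.mem_nhds hz] with x hx
      rw [hinv.logChart_eq hx]
  rw [hw.dz_eq, radialLogDeriv, if_neg hz, hr]
  have hc : conj z ≠ 0 := by simpa using hz
  rw [← Complex.mul_conj']
  field_simp

end HermitianMetric

/-! ### `L²` convergence of logarithmic derivatives on a disc -/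

theorem eLpNorm_two_sq {f : ℂ → ℂ} (μ : Measure ℂ) :
    eLpNorm f 2 μ ^ 2 = ∫⁻ z, ‖f z‖ₑ ^ 2 ∂μ := by
  have := eLpNorm_nnreal_pow_eq_lintegral (f := f) (μ := μ) (p := 2) two_ne_zero
  simpa using this

/-- The function `∂/∂z log h(e₀, e₀)`. -/
def dzLog {m : ℤ} (h : HermitianMetric m) : ℂ → ℂ :=
  dz fun x => (h.logChart x : ℂ)

theorem measurable_dz (f : ℂ → ℂ) : Measurable (dz f) :=
  measurable_const.mul ((measurable_fderiv_apply_const ℝ f 1).sub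
    (measurable_const.mul (measurable_fderiv_apply_const ℝ f Complex.I)))

theorem continuous_dzLog {m : ℤ} {h : HermitianMetric m} (hs : h.IsSmooth) :
    Continuous (dzLog h) :=
  (contDiff_dz (contDiff_ofReal_comp hs.contDiff_logChart)).continuous

theorem memLp_ball_of_continuous {f : ℂ → ℂ} (hf : Continuous f) (R : ℝ) (p : ℝ≥0∞) :
    MemLp f p (volume.restrict (Metric.ball 0 R)) := by
  obtain ⟨A, hA⟩ := (isCompact_closedBall (0 : ℂ) R).exists_bound_of_continuousOn hf.continuousOn
  have : IsFiniteMeasure (volume.restrict (Metric.ball (0 : ℂ) R)) :=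
    isFiniteMeasure_restrict.mpr measure_ball_lt_top.ne
  refine MemLp.of_bound hf.aestronglyMeasurable A ?_
  filter_upwards [ae_restrict_mem measurableSet_ball] with z hz
    using hA z (Metric.ball_subset_closedBall hz)

/-- The energy estimate for `-log hₙ` and `-log hₖ`, which are uniformly close and, for large
indices, uniformly bounded on the support of the cut-off. -/
theorem eLpNorm_dzLog_sub_cauchy {m : ℤ} {h : HermitianMetric m} {hn : ℕ → HermitianMetric m}
    (H : HermitianMetric.IsPositiveApproximation hn h) {ε : ℝ} (hε : 0 < ε) :
    ∃ N, ∀ n ≥ N, ∀ k ≥ N, eLpNorm (fun z => dzLog (hn n) z - dzLog (hn k) z) 2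
      (volume.restrict (Metric.ball 0 2)) ≤ ENNReal.ofReal ε := by
  -- Equal to `1` on the disc of radius `2`, which is where convergence is wanted, and supported in
  -- radius `3`.
  let χ : ContDiffBump (0 : ℂ) := ⟨2, 3, by norm_num, by norm_num⟩
  have hχs : ContDiff ℝ ∞ (χ : ℂ → ℝ) := χ.contDiff
  have hχt : tsupport χ = Metric.closedBall 0 3 := χ.tsupport_eq
  obtain ⟨M, hM⟩ := (isCompact_closedBall (0 : ℂ) 3).exists_bound_of_continuousOn
    h.continuous_logChart.continuousOn
  have hM0 : 0 ≤ M := (norm_nonneg _).trans (hM 0 (by simp))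
  set K : ℝ := ∫ z, |dzbardz χ z| with hK
  have hK0 : 0 ≤ K := integral_nonneg fun z => abs_nonneg _
  -- The estimate is used with `2 * δ` for the difference and `M + 1` for the bound. Since `δ ≤ 1`,
  -- its factor `(2δ)² / 2 + 2(M + 1)(2δ)` is at most `4δ(1 + (M + 1))`; the `+ 1` on `K` avoids
  -- division by zero.
  set δ : ℝ := min 1 (ε ^ 2 / (4 * (1 + (M + 1)) * (K + 1))) with hδd
  have hδ : 0 < δ := by positivity
  have hδ1 : δ ≤ 1 := min_le_left _ _
  have hδ2 : δ * (4 * (1 + (M + 1)) * (K + 1)) ≤ ε ^ 2 := by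
    rw [← le_div_iff₀ (by positivity)]
    exact min_le_right _ _
  obtain ⟨N, hN⟩ := eventually_atTop.mp (H.2.eventually_logChart hδ)
  refine ⟨N, fun n hn' k hk' => ?_⟩
  have hs : ∀ n, ContDiff ℝ ∞ fun z => -(hn n).logChart z :=
    fun n => (H.1 n).1.contDiff_logChart.neg
  have hb : ∀ n ≥ N, ∀ z ∈ tsupport χ, |-(hn n).logChart z| ≤ M + 1 := fun n hn' z hz => by
    have h1 := hN n hn' z
    have h2 := hM z (hχt ▸ hz)
    rw [Real.norm_eq_abs] at h2
    rw [abs_neg]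
    have h3 := abs_add_le ((hn n).logChart z - h.logChart z) (h.logChart z)
    rw [sub_add_cancel] at h3
    linarith
  have hd : ∀ z ∈ tsupport χ, |-(hn n).logChart z - -(hn k).logChart z| ≤ 2 * δ := fun z _ => by
    have h1 := abs_lt.mp (hN n hn' z)
    have h2 := abs_lt.mp (hN k hk' z)
    rw [abs_le]
    constructor <;> linarith [h1.1, h1.2, h2.1, h2.2]
  have key := integral_bump_mul_norm_dz_sq_le (hs n) (hs k) hχs χ.hasCompactSupport
    (fun z => χ.nonneg) (H.1 n).2.1 (H.1 k).2.1 (hb n hn') (hb k hk') hd (by positivity)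
  have hdz : ∀ z, ‖dz (fun x => ((-(hn n).logChart x - -(hn k).logChart x : ℝ) : ℂ)) z‖ =
      ‖dzLog (hn n) z - dzLog (hn k) z‖ := fun z => by
    have hw : ∀ n, HasWirtingerDerivAt (fun x => ((hn n).logChart x : ℂ)) _ _ z := fun n =>
      hasWirtingerDerivAt_of_differentiableAt
        ((contDiff_ofReal_comp (H.1 n).1.contDiff_logChart).differentiable (by simp) z)
    have h1 := (((hw n).sub (hw k)).const_mul (-1)).dz_eq
    have h2 : (fun x => ((-(hn n).logChart x - -(hn k).logChart x : ℝ) : ℂ)) =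
        fun x => -1 * (((hn n).logChart x : ℂ) - ((hn k).logChart x : ℂ)) := by
      funext x
      push_cast
      ring
    rw [h2, h1, neg_one_mul, norm_neg]
    rfl
  simp_rw [hdz] at key
  have hcont : Continuous fun z => χ z * ‖dzLog (hn n) z - dzLog (hn k) z‖ ^ 2 :=
    hχs.continuous.mul (((continuous_dzLog (H.1 n).1).sub
      (continuous_dzLog (H.1 k).1)).norm.pow 2)
  have hint : Integrable fun z => χ z * ‖dzLog (hn n) z - dzLog (hn k) z‖ ^ 2 :=
    hcont.integrable_of_hasCompactSupport χ.hasCompactSupport.mul_right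
  rw [← ENNReal.pow_le_pow_left_iff two_ne_zero, eLpNorm_two_sq, ← ENNReal.ofReal_pow hε.le]
  calc ∫⁻ z in Metric.ball 0 2, ‖dzLog (hn n) z - dzLog (hn k) z‖ₑ ^ 2
      ≤ ∫⁻ z in Metric.ball 0 2,
          ENNReal.ofReal (χ z * ‖dzLog (hn n) z - dzLog (hn k) z‖ ^ 2) := by
        refine setLIntegral_mono' measurableSet_ball fun z hz => ?_
        rw [χ.one_of_mem_closedBall (Metric.ball_subset_closedBall hz), one_mul,
          ENNReal.ofReal_pow (norm_nonneg _), ofReal_norm]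
    _ ≤ ∫⁻ z, ENNReal.ofReal (χ z * ‖dzLog (hn n) z - dzLog (hn k) z‖ ^ 2) :=
        setLIntegral_le_lintegral _ _
    _ = ENNReal.ofReal (∫ z, χ z * ‖dzLog (hn n) z - dzLog (hn k) z‖ ^ 2) :=
        (ofReal_integral_eq_lintegral_ofReal hint (Eventually.of_forall fun z =>
          mul_nonneg χ.nonneg (sq_nonneg _))).symm
    _ ≤ ENNReal.ofReal (ε ^ 2) := by
        refine ENNReal.ofReal_le_ofReal (key.trans ?_)
        have h1 : δ ^ 2 ≤ δ := by nlinarith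
        have h2 : (2 * δ) ^ 2 / 2 + 2 * (M + 1) * (2 * δ) ≤ δ * (4 * (1 + (M + 1))) := by nlinarith
        calc _ ≤ δ * (4 * (1 + (M + 1))) * (K + 1) :=
              mul_le_mul h2 (by linarith) hK0 (by positivity)
          _ ≤ _ := by linarith

theorem integral_smul_eq_setIntegral {f : ℂ → ℂ} {g : ℂ → ℝ} {s : Set ℂ} (hg : tsupport g ⊆ s) :
    ∫ z in s, g z • f z = ∫ z, g z • f z :=
  setIntegral_eq_integral_of_forall_compl_eq_zero fun z hz => by
    rw [image_eq_zero_of_notMem_tsupport fun h => hz (hg h), zero_smul]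

/-- Completeness of `L²` supplies `G`. Pairing with a test function passes to the limit on both
sides of the integration by parts: on the left by `L²` convergence, on the right by uniform
convergence of the logarithms. -/
theorem exists_limit_dzLog {m : ℤ} {h : HermitianMetric m} {hn : ℕ → HermitianMetric m}
    (H : HermitianMetric.IsPositiveApproximation hn h) :
    ∃ G : ℂ → ℂ, MemLp G 2 (volume.restrict (Metric.ball 0 2)) ∧
      Tendsto (fun n => eLpNorm (fun z => dzLog (hn n) z - G z) 2
        (volume.restrict (Metric.ball 0 2))) atTop (𝓝 0) ∧
      ∀ g : ℂ → ℝ, ContDiff ℝ ∞ g → HasCompactSupport g → tsupport g ⊆ Metric.ball 0 2 →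
        ∫ z, g z • G z = -∫ z, (h.logChart z : ℂ) * dz (fun x => (g x : ℂ)) z := by
  set ν : Measure ℂ := volume.restrict (Metric.ball 0 2) with hν
  have hmem : ∀ n, MemLp (dzLog (hn n)) 2 ν := fun n =>
    memLp_ball_of_continuous (continuous_dzLog (H.1 n).1) 2 2
  set F : ℕ → Lp ℂ 2 ν := fun n => (hmem n).toLp _ with hF
  have hFc : CauchySeq F := by
    rw [Metric.cauchySeq_iff]
    intro ε hε
    obtain ⟨N, hN⟩ := eLpNorm_dzLog_sub_cauchy H (half_pos hε)
    refine ⟨N, fun n hn' k hk' => ?_⟩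
    have h1 : edist (F n) (F k) ≤ ENNReal.ofReal (ε / 2) := by
      rw [Lp.edist_toLp_toLp]
      exact hN n hn' k hk'
    rw [edist_dist] at h1
    exact ((ENNReal.ofReal_le_ofReal_iff (by positivity)).mp h1).trans_lt (half_lt_self hε)
  obtain ⟨G, hG⟩ := cauchySeq_tendsto_of_complete hFc
  have hlim : Tendsto (fun n => eLpNorm (fun z => dzLog (hn n) z - G z) 2 ν) atTop (𝓝 0) := by
    refine ((Lp.tendsto_Lp_iff_tendsto_eLpNorm' _ _).mp hG).congr fun n => ?_
    exact eLpNorm_congr_ae ((hmem n).coeFn_toLp.sub EventuallyEq.rfl)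
  refine ⟨G, Lp.memLp G, hlim, fun g hg hgc hgt => ?_⟩
  have hg' := contDiff_ofReal_comp hg
  have hgc' : HasCompactSupport fun x => (g x : ℂ) := hgc.comp_left (g := fun x : ℝ => (x : ℂ)) rfl
  have hgm : MemLp (fun x => (g x : ℂ)) 2 ν := memLp_ball_of_continuous hg'.continuous 2 2
  -- As `g` is real, the conjugation in the inner product disappears, and continuity of the inner
  -- product gives the limit.
  have hinner : ∀ (f : ℂ → ℂ) (f' : Lp ℂ 2 ν), f' =ᵐ[ν] f →
      inner ℂ (hgm.toLp _) f' = ∫ z, g z • f z := by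
    intro f f' hf
    rw [L2.inner_def, ← integral_smul_eq_setIntegral hgt]
    refine integral_congr_ae ?_
    filter_upwards [hf, hgm.coeFn_toLp] with z h1 h2
    rw [h1, h2]
    simp [mul_comm]
  have h1 : Tendsto (fun n => ∫ z, g z • dzLog (hn n) z) atTop (𝓝 (∫ z, g z • G z)) := by
    rw [← hinner G G EventuallyEq.rfl]
    refine ((tendsto_const_nhds (x := hgm.toLp _)).inner hG).congr fun n => ?_
    exact hinner _ _ (hmem n).coeFn_toLp
  have h2 : Tendsto (fun n => ∫ z, g z • dzLog (hn n) z) atTop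
      (𝓝 (-∫ z, (h.logChart z : ℂ) * dz (fun x => (g x : ℂ)) z)) := by
    have e : ∀ n, ∫ z, g z • dzLog (hn n) z =
        -∫ z, ((hn n).logChart z : ℂ) * dz (fun x => (g x : ℂ)) z := fun n => by
      rw [← integral_dz_mul (contDiff_ofReal_comp (H.1 n).1.contDiff_logChart) hg' hgc']
      refine integral_congr_ae (Eventually.of_forall fun z => ?_)
      simp [dzLog, mul_comm]
    simp_rw [e]
    refine Tendsto.neg ?_
    have hdc := (contDiff_dz hg').continuous
    have hdi : Integrable fun z => ‖dz (fun x => (g x : ℂ)) z‖ :=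
      hdc.norm.integrable_of_hasCompactSupport (hasCompactSupport_dz hgc').norm
    have hi : ∀ k : HermitianMetric m,
        Integrable fun z => (k.logChart z : ℂ) * dz (fun x => (g x : ℂ)) z := fun k =>
      ((Complex.continuous_ofReal.comp k.continuous_logChart).mul
        hdc).integrable_of_hasCompactSupport (hasCompactSupport_dz hgc').mul_left
    rw [Metric.tendsto_atTop]
    intro ε hε
    set K := ∫ z, ‖dz (fun x => (g x : ℂ)) z‖ with hK
    have hK0 : 0 ≤ K := integral_nonneg fun z => norm_nonneg _
    obtain ⟨N, hN⟩ := eventually_atTop.mp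
      (H.2.eventually_logChart (δ := ε / (K + 1)) (by positivity))
    refine ⟨N, fun n hn' => ?_⟩
    rw [dist_eq_norm, ← integral_sub (hi _) (hi _)]
    calc _ ≤ ∫ z, ε / (K + 1) * ‖dz (fun x => (g x : ℂ)) z‖ := by
          refine norm_integral_le_of_norm_le (hdi.const_mul _) (Eventually.of_forall fun z => ?_)
          rw [← sub_mul, norm_mul, ← Complex.ofReal_sub, Complex.norm_real]
          exact mul_le_mul_of_nonneg_right (hN n hn' z).le (norm_nonneg _)
      _ = ε * (K / (K + 1)) := by rw [integral_const_mul]; ring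
      _ < ε * 1 := by
          refine mul_lt_mul_of_pos_left ?_ hε
          rw [div_lt_one (by positivity)]
          linarith
      _ = ε := mul_one ε
  exact tendsto_nhds_unique h1 h2

/-! ### Weak derivative and pointwise derivative -/

/-- `L` is assembled from line derivatives, for which Lipschitz functions integrate by parts;
Rademacher's theorem identifies it with `dz` almost everywhere. -/
theorem exists_weak_dz_of_lipschitzWith {K : NNReal} {f : ℂ → ℝ} (hf : LipschitzWith K f) :
    ∃ L : ℂ → ℂ, LocallyIntegrable L ∧
      (∀ᵐ z, DifferentiableAt ℝ f z ∧ L z = dz (fun x => (f x : ℂ)) z) ∧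
      ∀ g : ℂ → ℝ, ContDiff ℝ ∞ g → HasCompactSupport g →
        ∫ z, g z • L z = -∫ z, (f z : ℂ) * dz (fun x => (g x : ℂ)) z := by
  have hloc : ∀ v, LocallyIntegrable fun z => lineDeriv ℝ f z v :=
    fun v => hf.locallyIntegrable_lineDeriv v
  have hlocC : ∀ v, LocallyIntegrable fun z => ((lineDeriv ℝ f z v : ℝ) : ℂ) := fun v x => by
    obtain ⟨s, hs, hi⟩ := hloc v x
    exact ⟨s, hs, hi.ofReal⟩
  refine ⟨fun z => (1 / 2 : ℂ) • (((lineDeriv ℝ f z 1 : ℝ) : ℂ) -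
    Complex.I • ((lineDeriv ℝ f z Complex.I : ℝ) : ℂ)), ?_, ?_, fun g hg hgc => ?_⟩
  · exact ((hlocC 1).sub ((hlocC Complex.I).smul Complex.I)).smul (1 / 2 : ℂ)
  · filter_upwards [hf.ae_differentiableAt] with z hz
    refine ⟨hz, ?_⟩
    rw [dz_ofReal hz, hz.lineDeriv_eq_fderiv, hz.lineDeriv_eq_fderiv]
    rfl
  · obtain ⟨D, hD⟩ := hg.lipschitzWith_of_hasCompactSupport hgc (by simp)
    have hgd : Differentiable ℝ g := hg.differentiable (by simp)
    have hparts : ∀ v, ∫ z, ((lineDeriv ℝ f z v * g z : ℝ) : ℂ) =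
        -∫ z, (((f z : ℝ) * fderiv ℝ g z v : ℝ) : ℂ) := fun v => by
      rw [integral_complex_ofReal, integral_complex_ofReal, hf.integral_lineDeriv_mul_eq hD hgc,
        ← Complex.ofReal_neg, ← integral_neg]
      congr 2
      funext z
      rw [(hgd z).lineDeriv_eq_fderiv, map_neg]
      ring
    have hi1 : ∀ v, Integrable fun z => ((lineDeriv ℝ f z v * g z : ℝ) : ℂ) := fun v => by
      have : Integrable fun z => lineDeriv ℝ f z v * g z :=
        (hloc v).integrable_smul_right_of_hasCompactSupport hg.continuous hgc
      exact this.ofReal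
    have hi2 : ∀ v, Integrable fun z => ((f z * fderiv ℝ g z v : ℝ) : ℂ) := fun v => by
      have hc : Continuous fun z => f z * fderiv ℝ g z v :=
        hf.continuous.mul ((hg.continuous_fderiv (by simp)).clm_apply continuous_const)
      exact (hc.integrable_of_hasCompactSupport (hgc.fderiv_apply (𝕜 := ℝ) v).mul_left).ofReal
    have e1 : ∀ z, g z • ((1 / 2 : ℂ) • (((lineDeriv ℝ f z 1 : ℝ) : ℂ) -
        Complex.I • ((lineDeriv ℝ f z Complex.I : ℝ) : ℂ))) =
        (1 / 2) * (((lineDeriv ℝ f z 1 * g z : ℝ) : ℂ) -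
          Complex.I * ((lineDeriv ℝ f z Complex.I * g z : ℝ) : ℂ)) := fun z => by
      simp only [smul_eq_mul, Complex.real_smul, Complex.ofReal_mul]
      ring
    have e2 : ∀ z, (f z : ℂ) * dz (fun x => (g x : ℂ)) z =
        (1 / 2) * (((f z * fderiv ℝ g z 1 : ℝ) : ℂ) -
          Complex.I * ((f z * fderiv ℝ g z Complex.I : ℝ) : ℂ)) := fun z => by
      rw [dz_ofReal (hgd z)]
      push_cast
      ring
    simp_rw [e1, e2]
    rw [integral_const_mul, integral_const_mul, integral_sub (hi1 _) ((hi1 _).const_mul _),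
      integral_sub (hi2 _) ((hi2 _).const_mul _), integral_const_mul, integral_const_mul,
      hparts, hparts]
    ring

/-- Local null sets add up to a null set, and the origin is itself null. It may thus be left out,
which matters because the Lipschitz bound is established only away from it. -/
theorem ae_of_forall_ne_zero_nhds {p : ℂ → Prop}
    (h : ∀ z, z ≠ 0 → ∃ U ∈ 𝓝 z, ∀ᵐ x, x ∈ U → p x) : ∀ᵐ x : ℂ, p x := by
  have h0 : ∀ᵐ x : ℂ, x ≠ 0 := by simp [ae_iff]
  have h1 : volume {x : ℂ | x ≠ 0 ∧ ¬ p x} = 0 := by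
    refine measure_null_of_locally_null _ fun z hz => ?_
    obtain ⟨U, hU, hp⟩ := h z hz.1
    refine ⟨U ∩ {x | x ≠ 0 ∧ ¬ p x}, inter_mem (mem_nhdsWithin_of_mem_nhds hU) self_mem_nhdsWithin,
      measure_mono_null (fun x hx => ?_) (ae_iff.mp hp)⟩
    exact fun H => hx.2.2 (H hx.1)
  have h2 : ∀ᵐ x : ℂ, ¬(x ≠ 0 ∧ ¬ p x) := measure_eq_zero_iff_ae_notMem.mp h1
  filter_upwards [h0, h2] with x h2 h3
  by_contra h4
  exact h3 ⟨h2, h4⟩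

/-- Replaces a local Lipschitz function by a global one, so that Rademacher's theorem and
integration by parts on all of `ℂ` apply. -/
theorem exists_open_lipschitz_extension {f : ℂ → ℝ} {z : ℂ}
    (h : ∃ K, ∃ t ∈ 𝓝 z, LipschitzOnWith K f t) :
    ∃ (K : NNReal) (F : ℂ → ℝ) (U : Set ℂ), IsOpen U ∧ z ∈ U ∧ LipschitzWith K F ∧ EqOn f F U := by
  obtain ⟨K, t, ht, hK⟩ := h
  obtain ⟨F, hF, hFe⟩ := hK.extend_real
  obtain ⟨U, hUt, hU, hzU⟩ := mem_nhds_iff.mp ht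
  exact ⟨K, F, U, hU, hzU, hF, hFe.mono hUt⟩

theorem ae_differentiableAt_logChart {m : ℤ} {h : HermitianMetric m} (hadm : h.IsAdmissible)
    (hinv : h.IsCircleInvariant) : ∀ᵐ z, DifferentiableAt ℝ h.logChart z := by
  refine ae_of_forall_ne_zero_nhds fun z hz => ?_
  obtain ⟨K, F, U, hU, hzU, hF, hFe⟩ :=
    exists_open_lipschitz_extension (h.exists_lipschitzOnWith_logChart hadm hinv hz)
  refine ⟨U, hU.mem_nhds hzU, ?_⟩
  filter_upwards [hF.ae_differentiableAt] with x hx hxU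
  exact hx.congr_of_eventuallyEq (hFe.eventuallyEq_of_mem (hU.mem_nhds hxU))

/-- Near a point other than the origin, `G` and the weak derivative of the Lipschitz extension have
the same integrals against all test functions, so they agree almost everywhere there. -/
theorem ae_eq_dzLog_of_weak {m : ℤ} {h : HermitianMetric m} (hadm : h.IsAdmissible)
    (hinv : h.IsCircleInvariant) {G : ℂ → ℂ}
    (hG : MemLp G 2 (volume.restrict (Metric.ball 0 2)))
    (hw : ∀ g : ℂ → ℝ, ContDiff ℝ ∞ g → HasCompactSupport g → tsupport g ⊆ Metric.ball 0 2 →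
      ∫ z, g z • G z = -∫ z, (h.logChart z : ℂ) * dz (fun x => (g x : ℂ)) z) :
    G =ᵐ[volume.restrict (Metric.ball 0 2)] dzLog h := by
  have hfin : IsFiniteMeasure (volume.restrict (Metric.ball (0 : ℂ) 2)) :=
    isFiniteMeasure_restrict.mpr measure_ball_lt_top.ne
  rw [EventuallyEq, ae_restrict_iff' measurableSet_ball]
  refine ae_of_forall_ne_zero_nhds fun z hz => ?_
  obtain ⟨K, F, U, hU, hzU, hF, hFe⟩ :=
    exists_open_lipschitz_extension (h.exists_lipschitzOnWith_logChart hadm hinv hz)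
  obtain ⟨L, hLi, hLd, hLw⟩ := exists_weak_dz_of_lipschitzWith hF
  have hGi : IntegrableOn G (Metric.ball 0 2) := hG.integrable one_le_two
  have hUo : IsOpen (U ∩ Metric.ball 0 2) := hU.inter Metric.isOpen_ball
  have hae := hUo.ae_eq_zero_of_integral_contDiff_smul_eq_zero (μ := volume)
    (f := fun x => G x - L x)
    ((hGi.mono_set inter_subset_right).locallyIntegrableOn.sub
      (hLi.locallyIntegrableOn _)) fun g hg hgc hgt => by
    have i1 : Integrable fun x => g x • G x := by
      rw [← integrableOn_iff_integrable_of_support_subset (s := U ∩ Metric.ball 0 2)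
        (fun x hx => hgt (subset_tsupport _ (fun h0 => hx (by simp [h0]))))]
      obtain ⟨C, hC⟩ := hgc.exists_bound_of_continuous hg.continuous
      exact (hGi.mono_set inter_subset_right).bdd_smul C hg.continuous.aestronglyMeasurable
        (Eventually.of_forall hC)
    have i2 : Integrable fun x => g x • L x :=
      hLi.integrable_smul_left_of_hasCompactSupport hg.continuous hgc
    simp_rw [smul_sub]
    rw [integral_sub i1 i2, hw g hg hgc (hgt.trans inter_subset_right), hLw g hg hgc, sub_eq_zero]
    congr 2
    funext x
    -- Off `U` the derivative of the test function vanishes, so exchanging `log h` for its extension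
    -- changes nothing.
    by_cases hx : x ∈ U
    · rw [hFe hx]
    · rw [dz_eq_zero_of_notMem_tsupport, mul_zero, mul_zero]
      rw [tsupport_ofReal_comp]
      exact fun h0 => hx (hgt h0).1
  refine ⟨U, hU.mem_nhds hzU, ?_⟩
  filter_upwards [hae, hLd] with x h1 h2 hxU hxB
  have h3 : (fun y => (h.logChart y : ℂ)) =ᶠ[𝓝 x] fun y => (F y : ℂ) := by
    filter_upwards [hU.mem_nhds hxU] with y hy
    rw [hFe hy]
  rw [sub_eq_zero.mp (h1 ⟨hxU, hxB⟩), h2.2, dzLog, dz, dz, h3.fderiv_eq]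

/-- The logarithmic derivatives of smooth approximating metrics converge locally in `L²`. -/
theorem tendsto_eLpNorm_dzLog {m m₁ m₂ : ℤ} {h : HermitianMetric m} {h₁ : HermitianMetric m₁}
    {h₂ : HermitianMetric m₂} {h₁n : ℕ → HermitianMetric m₁} {h₂n : ℕ → HermitianMetric m₂}
    {hn : ℕ → HermitianMetric m} (hadm : h.IsAdmissible) (hinv : h.IsCircleInvariant)
    (hq : h.IsQuotient h₁ h₂) (H₁ : HermitianMetric.IsPositiveApproximation h₁n h₁)
    (H₂ : HermitianMetric.IsPositiveApproximation h₂n h₂)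
    (hqn : ∀ n, (hn n).IsQuotient (h₁n n) (h₂n n)) :
    MemLp (dzLog h) 2 (volume.restrict (Metric.ball 0 2)) ∧
      Tendsto (fun n => eLpNorm (fun z => dzLog (hn n) z - dzLog h z) 2
        (volume.restrict (Metric.ball 0 2))) atTop (𝓝 0) := by
  obtain ⟨G₁, hG₁, hl₁, hw₁⟩ := exists_limit_dzLog H₁
  obtain ⟨G₂, hG₂, hl₂, hw₂⟩ := exists_limit_dzLog H₂
  have hG : MemLp (fun z => G₁ z - G₂ z) 2 (volume.restrict (Metric.ball 0 2)) := hG₁.sub hG₂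
  have hfin : IsFiniteMeasure (volume.restrict (Metric.ball (0 : ℂ) 2)) :=
    isFiniteMeasure_restrict.mpr measure_ball_lt_top.ne
  -- Only the difference is identified: `h₁` and `h₂` need not be circle invariant, so `G₁` and `G₂`
  -- separately have no radial description.
  have hae : (fun z => G₁ z - G₂ z) =ᵐ[volume.restrict (Metric.ball 0 2)] dzLog h := by
    refine ae_eq_dzLog_of_weak hadm hinv hG fun g hg hgc hgt => ?_
    obtain ⟨C, hC⟩ := hgc.exists_bound_of_continuous hg.continuous
    have i : ∀ G : ℂ → ℂ, MemLp G 2 (volume.restrict (Metric.ball 0 2)) →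
        Integrable (fun z => g z • G z) (volume.restrict (Metric.ball 0 2)) := fun G hG =>
      (hG.integrable one_le_two).bdd_smul C hg.continuous.aestronglyMeasurable
        (Eventually.of_forall hC)
    have hgc' : HasCompactSupport fun x => (g x : ℂ) :=
      hgc.comp_left (g := fun x : ℝ => (x : ℂ)) rfl
    have j : ∀ {m' : ℤ} (k : HermitianMetric m'),
        Integrable fun z => (k.logChart z : ℂ) * dz (fun x => (g x : ℂ)) z := fun k =>
      ((Complex.continuous_ofReal.comp k.continuous_logChart).mul
        (contDiff_dz (contDiff_ofReal_comp hg)).continuous).integrable_of_hasCompactSupport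
        (hasCompactSupport_dz hgc').mul_left
    rw [← integral_smul_eq_setIntegral hgt]
    simp_rw [smul_sub, hq.logChart_eq, Complex.ofReal_sub, sub_mul]
    rw [integral_sub (i _ hG₁) (i _ hG₂), integral_sub (j _) (j _),
      integral_smul_eq_setIntegral hgt, integral_smul_eq_setIntegral hgt, hw₁ g hg hgc hgt,
      hw₂ g hg hgc hgt]
    ring
  refine ⟨hG.ae_eq hae, ?_⟩
  have hsum := hl₁.add hl₂
  rw [add_zero] at hsum
  refine tendsto_of_tendsto_of_tendsto_of_le_of_le tendsto_const_nhds hsum (fun _ => zero_le)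
    fun n => ?_
  have hd : ∀ z, dzLog (hn n) z = dzLog (h₁n n) z - dzLog (h₂n n) z := fun z => by
    have e : (fun x => ((hn n).logChart x : ℂ)) =
        fun x => ((h₁n n).logChart x : ℂ) - ((h₂n n).logChart x : ℂ) := by
      funext x
      rw [(hqn n).logChart_eq, Complex.ofReal_sub]
    rw [dzLog, e, ((hasWirtingerDerivAt_of_differentiableAt ((contDiff_ofReal_comp
      (H₁.1 n).1.contDiff_logChart).differentiable (by simp) z)).sub
      (hasWirtingerDerivAt_of_differentiableAt ((contDiff_ofReal_comp
      (H₂.1 n).1.contDiff_logChart).differentiable (by simp) z))).dz_eq]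
    rfl
  refine le_trans (le_of_eq (eLpNorm_congr_ae ?_)) (eLpNorm_sub_le
    ((continuous_dzLog (H₁.1 n).1).aestronglyMeasurable.sub hG₁.1)
    ((continuous_dzLog (H₂.1 n).1).aestronglyMeasurable.sub hG₂.1) one_le_two)
  filter_upwards [hae] with z hz
  simp only [Pi.sub_apply]
  rw [← hz, hd]
  ring

/-! ### The Laplacian in the frame and its change of chart -/

/-- The operator `-h_X(∂/∂z, ∂/∂z)⁻¹ (∂²/∂z∂z̄ + L ∂/∂z̄)` on coefficients of sections. -/
def laplacianWith (hX : HermitianMetric 2) (L s : ℂ → ℂ) (z : ℂ) : ℂ :=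
  -((hX.chart₀ z : ℂ)⁻¹ * (dz (dzbar s) z + L z * dzbar s z))

theorem hasWirtingerDerivAt_chart {m : ℤ} {h : HermitianMetric m} {z : ℂ}
    (hd : DifferentiableAt ℝ h.logChart z) :
    HasWirtingerDerivAt (fun x => (h.chart₀ x : ℂ)) (h.chart₀ z * dzLog h z)
      (h.chart₀ z * dzbar (fun x => (h.logChart x : ℂ)) z) z := by
  have h1 := hasWirtingerDerivAt_of_differentiableAt (differentiableAt_ofReal_comp_iff.mpr hd)
  have e : ∀ x, (h.chart₀ x : ℂ) = Complex.exp (h.logChart x) := fun x => by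
    rw [← Complex.ofReal_exp, HermitianMetric.logChart, Real.exp_log (h.pos₀ x)]
  refine HasFDerivAt.congr_of_eventuallyEq (f := fun x => Complex.exp (h.logChart x)) ?_
    (Eventually.of_forall e)
  refine (HasFDerivAt.cexp h1).congr_fderiv ?_
  ext v
  simp only [smul_apply, wirtingerMap_apply, smul_eq_mul, e, dzLog]
  ring

/-- The factor `h⁻¹` cancels `h` after the product rule, and only `∂ log h` is left of the metric.
-/
theorem dbarAdjoint_eq {m : ℤ} (hX : HermitianMetric 2) {h : HermitianMetric m} {s : ℂ → ℂ}
    (hs : ContDiff ℝ ∞ s) {z : ℂ} (hd : DifferentiableAt ℝ h.logChart z) :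
    dbarAdjoint hX h (dzbar s) z = laplacianWith hX (dzLog h) s z := by
  have h0 : (h.chart₀ z : ℂ) ≠ 0 := Complex.ofReal_ne_zero.mpr (h.pos₀ z).ne'
  rw [dbarAdjoint, ((hasWirtingerDerivAt_chart hd).mul (hasWirtingerDerivAt_of_differentiableAt
    ((contDiff_dzbar hs).differentiable (by simp) z))).dz_eq, laplacianWith]
  field_simp
  ring

theorem laplacian_eq {m : ℤ} (hX : HermitianMetric 2) {h : HermitianMetric m} (hs : h.IsSmooth)
    (ξ : SmoothSection m) : laplacian hX h ξ = laplacianWith hX (dzLog h) ξ.1.1 :=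
  funext fun z => dbarAdjoint_eq hX ξ.2.1 (hs.contDiff_logChart.differentiable (by simp) z)

theorem measurable_dzbar (f : ℂ → ℂ) : Measurable (dzbar f) :=
  measurable_const.mul ((measurable_fderiv_apply_const ℝ f 1).add
    (measurable_const.mul (measurable_fderiv_apply_const ℝ f Complex.I)))

theorem measurable_laplacianWith (hX : HermitianMetric 2) {L : ℂ → ℂ} (hL : Measurable L)
    (s : ℂ → ℂ) : Measurable (laplacianWith hX L s) :=
  (((Complex.measurable_ofReal.comp hX.continuous₀.measurable).inv).mul
    ((measurable_dz _).add (hL.mul (measurable_dzbar s)))).neg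

/-- The same section, with the two charts exchanged. -/
def swapSection {m : ℤ} (ξ : SmoothSection m) : SmoothSection m :=
  ⟨(ξ.1.2, ξ.1.1), ξ.2.2.1, ξ.2.1, fun z hz => by
    have := ξ.2.2.2 z⁻¹ (inv_ne_zero hz)
    rw [inv_inv] at this
    change ξ.1.2 z = z ^ m * ξ.1.1 z⁻¹
    rw [this, inv_zpow, mul_inv_cancel_left₀ (zpow_ne_zero m hz)]⟩

/-- Differentiation of `logChart_swap_inv`: the transition factor gives `-m / z`, the inversion
gives `-z⁻²`. Only differentiability at the point is required, so the limit metric is covered as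
well as the smooth ones. -/
theorem dzLog_eq_swap {m : ℤ} {h : HermitianMetric m} {z : ℂ} (hz : z ≠ 0)
    (hd : DifferentiableAt ℝ h.logChart z) :
    dzLog h z = -(m / z) - (z ^ 2)⁻¹ * dzLog h.swap z⁻¹ := by
  have hz' : z⁻¹ ≠ 0 := inv_ne_zero hz
  have h1 : HasWirtingerDerivAt (fun x => (h.logChart x : ℂ)) (dzLog h z)
      (dzbar (fun x => (h.logChart x : ℂ)) z) z⁻¹⁻¹ := by
    rw [inv_inv]
    exact hasWirtingerDerivAt_of_differentiableAt (differentiableAt_ofReal_comp_iff.mpr hd)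
  have h2 := (hasWirtingerDerivAt_inv hz' h1).sub
    ((hasWirtingerDerivAt_log_norm hz').const_mul (2 * m))
  have h3 := (h2.congr_of_eventuallyEq (g := fun x => (h.swap.logChart x : ℂ)) (by
    filter_upwards [isOpen_ne.mem_nhds hz'] with x hx
    rw [h.swap.logChart_swap_inv hx]
    push_cast
    rfl)).dz_eq
  rw [show dzLog h.swap z⁻¹ = _ from h3]
  field_simp
  ring

/-- If `L` transforms like a connection form of `O(m)`, the operator maps sections to sections. No
metric on `O(m)` enters, so approximating and limit operators are handled together. -/
theorem laplacianWith_eq_swap {m : ℤ} (hX : HermitianMetric 2) (ξ : SmoothSection m)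
    {L L' : ℂ → ℂ} {z : ℂ} (hz : z ≠ 0) (hL : L z = -(m / z) - (z ^ 2)⁻¹ * L' z⁻¹) :
    laplacianWith hX L ξ.1.1 z = z ^ m * laplacianWith hX.swap L' (swapSection ξ).1.1 z⁻¹ := by
  change _ = z ^ m * laplacianWith hX.swap L' ξ.1.2 z⁻¹
  have hzb : conj z ≠ 0 := by simpa using hz
  have hd₁ : Differentiable ℝ ξ.1.2 := ξ.2.2.1.differentiable (by simp)
  have hdd₁ : Differentiable ℝ (dzbar ξ.1.2) :=
    (contDiff_dzbar ξ.2.2.1).differentiable (by simp)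
  have hpow : ∀ x : ℂ, x ≠ 0 → HasWirtingerDerivAt (fun x => x ^ m) (m * x ^ (m - 1)) 0 x :=
    fun x hx => HasDerivAt.hasWirtingerDerivAt (hasDerivAt_zpow m x (Or.inl hx))
  have e1 : ∀ x : ℂ, x ≠ 0 →
      dzbar ξ.1.1 x = -1 * (x ^ m * (conj ((x ^ 2)⁻¹) * dzbar ξ.1.2 x⁻¹)) := fun x hx => by
    have h1 := (hpow x hx).mul
      (hasWirtingerDerivAt_inv hx (hasWirtingerDerivAt_of_differentiableAt (hd₁ x⁻¹)))
    rw [(h1.congr_of_eventuallyEq (g := ξ.1.1) (by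
      filter_upwards [isOpen_ne.mem_nhds hx] with y hy using ξ.2.2.2 y hy)).dzbar_eq]
    simp
  have hinv2 : HasDerivAt (fun x : ℂ => (x ^ 2)⁻¹) (-(2 * z) / (z ^ 2) ^ 2) z := by
    simpa using (hasDerivAt_pow 2 z).fun_inv (pow_ne_zero 2 hz)
  have h2 := ((hpow z hz).mul (((HasDerivAt.hasWirtingerDerivAt hinv2).conj_comp).mul
    (hasWirtingerDerivAt_inv hz
      (hasWirtingerDerivAt_of_differentiableAt (hdd₁ z⁻¹))))).const_mul (-1)
  have e2 := (h2.congr_of_eventuallyEq (g := dzbar ξ.1.1) (by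
    filter_upwards [isOpen_ne.mem_nhds hz] with y hy using e1 y hy)).dz_eq
  -- The gluing rule for the metric on the tangent bundle, with `‖z‖ ^ 4` written as `(z * conj z) ^
  -- 2` for the algebra below.
  have hg : (hX.chart₀ z : ℂ)⁻¹ = (z * conj z) ^ 2 * (hX.chart₁ z⁻¹ : ℂ)⁻¹ := by
    have h3 : (hX.chart₀ z : ℂ) ≠ 0 := Complex.ofReal_ne_zero.mpr (hX.pos₀ z).ne'
    have h4 : ((‖z‖ ^ (2 * (2 : ℤ)) : ℝ) : ℂ) = (z * conj z) ^ 2 := by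
      rw [Complex.mul_conj']
      push_cast
      rw [← pow_mul]
      norm_cast
    rw [hX.glue z hz, Complex.ofReal_mul, h4]
    have : (z * conj z) ^ 2 ≠ 0 := pow_ne_zero 2 (mul_ne_zero hz hzb)
    field_simp
  rw [laplacianWith, laplacianWith, e2, e1 z hz, hL, hg, zpow_sub_one₀ hz]
  change _ = z ^ m * -((hX.chart₁ z⁻¹ : ℂ)⁻¹ * _)
  simp only [map_zero, zero_mul, zero_add, map_inv₀, map_pow]
  field_simp
  ring

/-! ### The weighted `L²` norm on two discs -/

theorem abs_det_restrictScalars_toSpanSingleton (c : ℂ) :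
    |((ContinuousLinearMap.toSpanSingleton ℂ c).restrictScalars ℝ : ℂ →L[ℝ] ℂ).det| = ‖c‖ ^ 2 := by
  have : ((ContinuousLinearMap.toSpanSingleton ℂ c).restrictScalars ℝ : ℂ →L[ℝ] ℂ).det =
      Complex.normSq c := by
    rw [ContinuousLinearMap.det, ContinuousLinearMap.coe_restrictScalars,
      LinearMap.det_restrictScalars, Algebra.norm_complex_apply]
    congr 1
    exact ContinuousLinearMap.det_toSpanSingleton c
  rw [this, Complex.normSq_eq_norm_sq, abs_of_nonneg (sq_nonneg _)]

/-- Change of variables under inversion; the real Jacobian is the squared modulus of the derivative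
`-w⁻²`. -/
theorem lintegral_norm_gt_one_eq (f : ℂ → ℝ≥0∞) :
    ∫⁻ z in {z : ℂ | 1 < ‖z‖}, f z =
      ∫⁻ w in {w : ℂ | w ≠ 0 ∧ ‖w‖ < 1}, ENNReal.ofReal (‖w‖ ^ 4)⁻¹ * f w⁻¹ := by
  have hs : MeasurableSet {w : ℂ | w ≠ 0 ∧ ‖w‖ < 1} :=
    (isOpen_ne.inter (isOpen_lt continuous_norm continuous_const)).measurableSet
  have himg : (fun w : ℂ => w⁻¹) '' {w : ℂ | w ≠ 0 ∧ ‖w‖ < 1} = {z : ℂ | 1 < ‖z‖} := by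
    ext z
    constructor
    · rintro ⟨w, ⟨hw0, hw1⟩, rfl⟩
      change 1 < ‖w⁻¹‖
      rw [norm_inv]
      exact (one_lt_inv₀ (norm_pos_iff.mpr hw0)).mpr hw1
    · intro hz
      have hz' : 1 < ‖z‖ := hz
      have hz0 : z ≠ 0 := norm_pos_iff.mp (one_pos.trans hz')
      exact ⟨z⁻¹, ⟨inv_ne_zero hz0, by rw [norm_inv]; exact inv_lt_one_of_one_lt₀ hz'⟩, inv_inv z⟩
  rw [← himg, lintegral_image_eq_lintegral_abs_det_fderiv_mul volume hs
    (f' := fun w => (ContinuousLinearMap.toSpanSingleton ℂ (-(w ^ 2)⁻¹)).restrictScalars ℝ)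
    (fun w hw => ((hasDerivAt_inv hw.1).hasFDerivAt.restrictScalars ℝ).hasFDerivWithinAt)
    inv_injective.injOn]
  refine setLIntegral_congr_fun hs fun w _ => ?_
  simp only [abs_det_restrictScalars_toSpanSingleton]
  rw [norm_neg, norm_inv, norm_pow, inv_pow, ← pow_mul]

theorem measurable_weight_density {m : ℤ} (hX : HermitianMetric 2) (h : HermitianMetric m) :
    Measurable fun z => ENNReal.ofReal (hX.chart₀ z * h.chart₀ z / Real.pi) :=
  ((hX.continuous₀.mul h.continuous₀).div_const _).measurable.ennreal_ofReal

theorem weight_absolutelyContinuous {m : ℤ} (hX : HermitianMetric 2) (h : HermitianMetric m) :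
    weight hX h ≪ volume :=
  withDensity_absolutelyContinuous _ _

/-- The Jacobian cancels the gluing factor of `h_X`, and the transition function of the section
cancels that of `h`: the integrand is a global density. -/
theorem lintegral_weight_norm_gt_one {m : ℤ} (hX : HermitianMetric 2) (h : HermitianMetric m)
    {S S' : ℂ → ℂ} (hS : Measurable S) (hS' : Measurable S')
    (hSS : ∀ᵐ z, z ≠ 0 → S z = z ^ m * S' z⁻¹) :
    ∫⁻ z in {z : ℂ | 1 < ‖z‖}, ‖S z‖ₑ ^ 2 ∂weight hX h =
      ∫⁻ w in {w : ℂ | w ≠ 0 ∧ ‖w‖ < 1}, ‖S' w‖ₑ ^ 2 ∂weight hX.swap h.swap := by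
  have hs : MeasurableSet {w : ℂ | w ≠ 0 ∧ ‖w‖ < 1} :=
    (isOpen_ne.inter (isOpen_lt continuous_norm continuous_const)).measurableSet
  have hs1 : MeasurableSet {z : ℂ | 1 < ‖z‖} :=
    (isOpen_lt continuous_const continuous_norm).measurableSet
  rw [weight, weight, setLIntegral_withDensity_eq_setLIntegral_mul _
    (measurable_weight_density hX h) (hS.enorm.pow_const 2) hs1,
    setLIntegral_withDensity_eq_setLIntegral_mul _
    (measurable_weight_density hX.swap h.swap) (hS'.enorm.pow_const 2) hs]
  have e1 : ∫⁻ z in {z : ℂ | 1 < ‖z‖},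
      ENNReal.ofReal (hX.chart₀ z * h.chart₀ z / Real.pi) * ‖S z‖ₑ ^ 2 =
      ∫⁻ z in {z : ℂ | 1 < ‖z‖},
      ENNReal.ofReal (hX.chart₀ z * h.chart₀ z / Real.pi) * ‖z ^ m * S' z⁻¹‖ₑ ^ 2 := by
    refine setLIntegral_congr_fun_ae hs1 ?_
    filter_upwards [hSS] with z hz hz1
    rw [hz (norm_pos_iff.mp (one_pos.trans hz1))]
  refine e1.trans ((lintegral_norm_gt_one_eq _).trans (setLIntegral_congr_fun hs fun w hw => ?_))
  have hn : 0 < ‖w‖ := norm_pos_iff.mpr hw.1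
  have g1 : hX.chart₀ w⁻¹ = ‖w‖ ^ (2 * (2 : ℤ)) * hX.swap.chart₀ w := hX.swap.glue w hw.1
  have g2 : h.chart₀ w⁻¹ = ‖w‖ ^ (2 * m) * h.swap.chart₀ w := h.swap.glue w hw.1
  have p1 := hX.swap.pos₀ w
  have p2 := h.swap.pos₀ w
  have hp := Real.pi_pos
  simp only [Pi.mul_apply, inv_inv]
  rw [← ofReal_norm, ← ofReal_norm, ← ENNReal.ofReal_pow (norm_nonneg _),
    ← ENNReal.ofReal_pow (norm_nonneg _), g1, g2, ← ENNReal.ofReal_mul (by positivity),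
    ← ENNReal.ofReal_mul (by positivity), ← ENNReal.ofReal_mul (by positivity), norm_mul,
    norm_zpow, norm_inv]
  congr 1
  have e4 : ‖w‖ ^ (2 * m) = (‖w‖ ^ m) ^ 2 := by
    rw [mul_comm, zpow_mul]
    norm_cast
  have e5 : ‖w‖ ^ (2 * (2 : ℤ)) = ‖w‖ ^ 4 := by norm_cast
  have e6 : ‖w‖ ^ m ≠ 0 := (zpow_pos hn m).ne'
  rw [e4, e5, inv_zpow]
  field_simp

/-- A section is controlled in `L²` by its coefficients on two discs which cover the line. -/
theorem eLpNorm_weight_le {m : ℤ} (hX : HermitianMetric 2) (h : HermitianMetric m)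
    {S S' : ℂ → ℂ} (hS : Measurable S) (hS' : Measurable S')
    (hSS : ∀ᵐ z, z ≠ 0 → S z = z ^ m * S' z⁻¹) :
    eLpNorm S 2 (weight hX h) ≤ eLpNorm S 2 ((weight hX h).restrict (Metric.ball 0 2)) +
      eLpNorm S' 2 ((weight hX.swap h.swap).restrict (Metric.ball 0 2)) := by
  have hA : MeasurableSet (Metric.closedBall (0 : ℂ) 1) := measurableSet_closedBall
  have hAc : (Metric.closedBall (0 : ℂ) 1)ᶜ = {z : ℂ | 1 < ‖z‖} := by
    ext z
    simp
  rw [← ENNReal.pow_le_pow_left_iff two_ne_zero, eLpNorm_two_sq, ← lintegral_add_compl _ hA, hAc,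
    lintegral_weight_norm_gt_one hX h hS hS' hSS]
  calc _ ≤ (∫⁻ z in Metric.ball 0 2, ‖S z‖ₑ ^ 2 ∂weight hX h) +
        ∫⁻ w in Metric.ball 0 2, ‖S' w‖ₑ ^ 2 ∂weight hX.swap h.swap := by
        refine add_le_add (lintegral_mono_set (Metric.closedBall_subset_ball (by norm_num)))
          (lintegral_mono_set fun w hw => ?_)
        rw [mem_ball_zero_iff]
        linarith [hw.2]
    _ ≤ _ := by
        -- `a² + b² ≤ (a + b)²`, by dropping the mixed term.
        rw [← eLpNorm_two_sq, ← eLpNorm_two_sq, add_sq]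
        exact add_le_add le_self_add le_rfl

theorem exists_eLpNorm_weight_ball_le {m : ℤ} (hX : HermitianMetric 2) (h : HermitianMetric m) :
    ∃ C : ℝ≥0∞, C ≠ ⊤ ∧ ∀ f : ℂ → ℂ, eLpNorm f 2 ((weight hX h).restrict (Metric.ball 0 2)) ≤
      C * eLpNorm f 2 (volume.restrict (Metric.ball 0 2)) := by
  obtain ⟨A, hA⟩ := (isCompact_closedBall (0 : ℂ) 2).exists_bound_of_continuousOn
    ((hX.continuous₀.mul h.continuous₀).div_const Real.pi).continuousOn
  refine ⟨ENNReal.ofReal A ^ (1 / (2 : ℝ≥0∞)).toReal,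
    ENNReal.rpow_ne_top_of_nonneg ENNReal.toReal_nonneg ENNReal.ofReal_ne_top, fun f => ?_⟩
  rw [← smul_eq_mul, ← eLpNorm_smul_measure_of_ne_top (by simp)]
  refine eLpNorm_mono_measure _ ?_
  rw [weight, restrict_withDensity measurableSet_ball, ← withDensity_const]
  refine withDensity_mono ?_
  filter_upwards [ae_restrict_mem measurableSet_ball] with z hz
  exact ENNReal.ofReal_le_ofReal ((le_abs_self _).trans (hA z (Metric.ball_subset_closedBall hz)))

/-! ### Bounds and convergence of the Laplacians -/

theorem laplacianWith_add (hX : HermitianMetric 2) (L : ℂ → ℂ) {s t : ℂ → ℂ}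
    (hs : ContDiff ℝ ∞ s) (ht : ContDiff ℝ ∞ t) (z : ℂ) :
    laplacianWith hX L (fun x => s x + t x) z =
      laplacianWith hX L s z + laplacianWith hX L t z := by
  have e : dzbar (fun x => s x + t x) = fun x => dzbar s x + dzbar t x := funext fun x =>
    ((hasWirtingerDerivAt_of_differentiableAt (hs.differentiable (by simp) x)).add
      (hasWirtingerDerivAt_of_differentiableAt (ht.differentiable (by simp) x))).dzbar_eq
  rw [laplacianWith, e, ((hasWirtingerDerivAt_of_differentiableAt
    ((contDiff_dzbar hs).differentiable (by simp) z)).add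
    (hasWirtingerDerivAt_of_differentiableAt
      ((contDiff_dzbar ht).differentiable (by simp) z))).dz_eq, laplacianWith, laplacianWith]
  ring

theorem laplacianWith_const_mul (hX : HermitianMetric 2) (L : ℂ → ℂ) (c : ℂ) {s : ℂ → ℂ}
    (hs : ContDiff ℝ ∞ s) (z : ℂ) :
    laplacianWith hX L (fun x => c * s x) z = c * laplacianWith hX L s z := by
  have e : dzbar (fun x => c * s x) = fun x => c * dzbar s x := funext fun x =>
    ((hasWirtingerDerivAt_of_differentiableAt (hs.differentiable (by simp) x)).const_mul
      c).dzbar_eq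
  rw [laplacianWith, e, ((hasWirtingerDerivAt_of_differentiableAt
    ((contDiff_dzbar hs).differentiable (by simp) z)).const_mul c).dz_eq, laplacianWith]
  ring

theorem continuous_inv_chart_mul (hX : HermitianMetric 2) {f : ℂ → ℂ} (hf : Continuous f) :
    Continuous fun z => (hX.chart₀ z : ℂ)⁻¹ * f z :=
  ((Complex.continuous_ofReal.comp hX.continuous₀).inv₀ fun z =>
    Complex.ofReal_ne_zero.mpr (hX.pos₀ z).ne').mul hf

/-- The second-order terms cancel, leaving `h_X⁻¹ (∂̄s) (L - L')` up to sign. The constant depends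
on `s` but not on `L` or `L'`. -/
theorem exists_eLpNorm_laplacianWith_sub_le (hX : HermitianMetric 2) {s : ℂ → ℂ}
    (hs : ContDiff ℝ ∞ s) : ∃ C : ℝ, ∀ L L' : ℂ → ℂ,
      eLpNorm (fun z => laplacianWith hX L s z - laplacianWith hX L' s z) 2
        (volume.restrict (Metric.ball 0 2)) ≤
      ENNReal.ofReal C * eLpNorm (fun z => L z - L' z) 2 (volume.restrict (Metric.ball 0 2)) := by
  obtain ⟨C, hC⟩ := (isCompact_closedBall (0 : ℂ) 2).exists_bound_of_continuousOn
    (continuous_inv_chart_mul hX (contDiff_dzbar hs).continuous).continuousOn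
  refine ⟨C, fun L L' => eLpNorm_le_mul_eLpNorm_of_ae_le_mul ?_ _⟩
  filter_upwards [ae_restrict_mem measurableSet_ball] with z hz
  have e : laplacianWith hX L s z - laplacianWith hX L' s z =
      -(((hX.chart₀ z : ℂ)⁻¹ * dzbar s z) * (L z - L' z)) := by
    rw [laplacianWith, laplacianWith]
    ring
  rw [e, norm_neg, norm_mul]
  exact mul_le_mul_of_nonneg_right (hC z (Metric.ball_subset_closedBall hz)) (norm_nonneg _)

theorem memLp_laplacianWith_ball (hX : HermitianMetric 2) {s : ℂ → ℂ} (hs : ContDiff ℝ ∞ s)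
    {L : ℂ → ℂ} (hL : MemLp L 2 (volume.restrict (Metric.ball 0 2))) :
    eLpNorm (laplacianWith hX L s) 2 (volume.restrict (Metric.ball 0 2)) < ⊤ := by
  obtain ⟨C, hC⟩ := (isCompact_closedBall (0 : ℂ) 2).exists_bound_of_continuousOn
    (continuous_inv_chart_mul hX (contDiff_dzbar hs).continuous).continuousOn
  have h1 : MemLp (fun z => (hX.chart₀ z : ℂ)⁻¹ * dz (dzbar s) z) 2
      (volume.restrict (Metric.ball 0 2)) := memLp_ball_of_continuous
    (continuous_inv_chart_mul hX (contDiff_dz (contDiff_dzbar hs)).continuous) 2 2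
  have h2 : MemLp (fun z => ((hX.chart₀ z : ℂ)⁻¹ * dzbar s z) * L z) 2
      (volume.restrict (Metric.ball 0 2)) := by
    refine hL.of_le_mul (c := C) ((continuous_inv_chart_mul hX
      (contDiff_dzbar hs).continuous).aestronglyMeasurable.mul hL.1) ?_
    filter_upwards [ae_restrict_mem measurableSet_ball] with z hz
    rw [norm_mul]
    exact mul_le_mul_of_nonneg_right (hC z (Metric.ball_subset_closedBall hz)) (norm_nonneg _)
  refine lt_of_le_of_lt (le_of_eq (congrArg (fun f => eLpNorm f 2 _) ?_)) (h1.add h2).neg.2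
  funext z
  simp only [Pi.neg_apply, Pi.add_apply, laplacianWith]
  ring

namespace HermitianMetric

/-- The trivial metric on `O(0)`. -/
def trivial : HermitianMetric 0 where
  chart₀ _ := 1
  chart₁ _ := 1
  continuous₀ := continuous_const
  continuous₁ := continuous_const
  pos₀ _ := one_pos
  pos₁ _ := one_pos
  glue _ _ := by simp

theorem isPositiveApproximation_trivial :
    IsPositiveApproximation (fun _ => trivial) trivial := by
  have h0 : ∀ z : ℂ, 0 ≤ (dz (dzbar fun _ => ((-Real.log 1 : ℝ) : ℂ)) z).re := fun z => by
    have e : dzbar (fun _ : ℂ => ((-Real.log 1 : ℝ) : ℂ)) = fun _ => 0 := by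
      funext x
      simp [dzbar]
    rw [e]
    simp [dz]
  refine ⟨fun _ => ⟨⟨contDiff_const, contDiff_const⟩, h0, h0⟩, ?_, ?_⟩ <;>
  · rw [Metric.tendstoUniformly_iff]
    intro ε hε
    simp [trivial, hε]

/-- This decomposition makes the condition defining the limit Laplacian non-vacuous for admissible
`h`. -/
theorem isQuotient_trivial {m : ℤ} (h : HermitianMetric m) : h.IsQuotient h trivial :=
  ⟨(sub_zero m).symm, fun _ => (div_one _).symm, fun _ => (div_one _).symm⟩

theorem IsAdmissible.memLp_dzLog {m : ℤ} {h : HermitianMetric m} (hadm : h.IsAdmissible)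
    (hinv : h.IsCircleInvariant) : MemLp (dzLog h) 2 (volume.restrict (Metric.ball 0 2)) := by
  obtain ⟨hn, H⟩ := id hadm
  exact (tendsto_eLpNorm_dzLog hadm hinv h.isQuotient_trivial H isPositiveApproximation_trivial
    fun n => (hn n).isQuotient_trivial).1

end HermitianMetric

theorem measurable_dzLog {m : ℤ} (h : HermitianMetric m) : Measurable (dzLog h) :=
  measurable_dz _

theorem ae_laplacianWith_dzLog_eq_swap {m : ℤ} (hX : HermitianMetric 2) {h : HermitianMetric m}
    (hd : ∀ᵐ z, DifferentiableAt ℝ h.logChart z) (ξ : SmoothSection m) :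
    ∀ᵐ z, z ≠ 0 → laplacianWith hX (dzLog h) ξ.1.1 z =
      z ^ m * laplacianWith hX.swap (dzLog h.swap) (swapSection ξ).1.1 z⁻¹ := by
  filter_upwards [hd] with z hz hz0
  exact laplacianWith_eq_swap hX ξ hz0 (dzLog_eq_swap hz0 hz)

theorem memLp_laplacianWith {m : ℤ} (hX : HermitianMetric 2) {h : HermitianMetric m}
    (hadm : h.IsAdmissible) (hinv : h.IsCircleInvariant) (ξ : SmoothSection m) :
    MemLp (laplacianWith hX (dzLog h) ξ.1.1) 2 (weight hX h) := by
  have hm := measurable_laplacianWith hX (measurable_dzLog h) ξ.1.1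
  have hm' := measurable_laplacianWith hX.swap (measurable_dzLog h.swap) (swapSection ξ).1.1
  refine ⟨hm.aestronglyMeasurable, (eLpNorm_weight_le hX h hm hm'
    (ae_laplacianWith_dzLog_eq_swap hX (ae_differentiableAt_logChart hadm hinv) ξ)).trans_lt ?_⟩
  obtain ⟨C, hC, hC'⟩ := exists_eLpNorm_weight_ball_le hX h
  obtain ⟨D, hD, hD'⟩ := exists_eLpNorm_weight_ball_le hX.swap h.swap
  exact ENNReal.add_lt_top.mpr
    ⟨(hC' _).trans_lt (ENNReal.mul_lt_top hC.lt_top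
      (memLp_laplacianWith_ball hX ξ.2.1 (hadm.memLp_dzLog hinv))),
    (hD' _).trans_lt (ENNReal.mul_lt_top hD.lt_top
      (memLp_laplacianWith_ball hX.swap (swapSection ξ).2.1
        (hadm.swap.memLp_dzLog hinv.swap)))⟩

/-- Convergence of `dzLog` on the disc of radius `2` in each chart is enough: differences of
Laplacians transform as sections, so two discs control the global norm. -/
theorem tendsto_eLpNorm_laplacian_sub {m m₁ m₂ : ℤ} (hX : HermitianMetric 2)
    {h : HermitianMetric m} {h₁ : HermitianMetric m₁}
    {h₂ : HermitianMetric m₂} {h₁n : ℕ → HermitianMetric m₁} {h₂n : ℕ → HermitianMetric m₂}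
    {hn : ℕ → HermitianMetric m} (hadm : h.IsAdmissible) (hinv : h.IsCircleInvariant)
    (hq : h.IsQuotient h₁ h₂) (H₁ : HermitianMetric.IsPositiveApproximation h₁n h₁)
    (H₂ : HermitianMetric.IsPositiveApproximation h₂n h₂)
    (hqn : ∀ n, (hn n).IsQuotient (h₁n n) (h₂n n)) (ξ : SmoothSection m) :
    Tendsto (fun n => eLpNorm (fun z => laplacian hX (hn n) ξ z -
      laplacianWith hX (dzLog h) ξ.1.1 z) 2 (weight hX h)) atTop (𝓝 0) := by
  have hns : ∀ n, (hn n).IsSmooth := fun n => by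
    have e0 : (hn n).chart₀ = fun z => (h₁n n).chart₀ z / (h₂n n).chart₀ z :=
      funext (hqn n).2.1
    have e1 : (hn n).chart₁ = fun z => (h₁n n).chart₁ z / (h₂n n).chart₁ z :=
      funext (hqn n).2.2
    exact ⟨e0 ▸ (H₁.1 n).1.1.div (H₂.1 n).1.1 fun z => ((h₂n n).pos₀ z).ne',
      e1 ▸ (H₁.1 n).1.2.div (H₂.1 n).1.2 fun z => ((h₂n n).pos₁ z).ne'⟩
  have hd := ae_differentiableAt_logChart hadm hinv
  have t₀ := (tendsto_eLpNorm_dzLog hadm hinv hq H₁ H₂ hqn).2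
  have t₁ := (tendsto_eLpNorm_dzLog hadm.swap hinv.swap hq.swap H₁.swap H₂.swap
    fun n => (hqn n).swap).2
  obtain ⟨C, hC, hC'⟩ := exists_eLpNorm_weight_ball_le hX h
  obtain ⟨D, hD, hD'⟩ := exists_eLpNorm_weight_ball_le hX.swap h.swap
  obtain ⟨A, hA⟩ := exists_eLpNorm_laplacianWith_sub_le hX ξ.2.1
  obtain ⟨B, hB⟩ := exists_eLpNorm_laplacianWith_sub_le hX.swap (swapSection ξ).2.1
  have hsum := (ENNReal.Tendsto.const_mul (a := C * ENNReal.ofReal A) t₀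
    (Or.inr (ENNReal.mul_ne_top hC ENNReal.ofReal_ne_top))).add
    (ENNReal.Tendsto.const_mul (a := D * ENNReal.ofReal B) t₁
    (Or.inr (ENNReal.mul_ne_top hD ENNReal.ofReal_ne_top)))
  rw [mul_zero, mul_zero, add_zero] at hsum
  refine tendsto_of_tendsto_of_tendsto_of_le_of_le tendsto_const_nhds hsum (fun _ => zero_le)
    fun n => ?_
  have hS : ∀ᵐ z, z ≠ 0 → laplacian hX (hn n) ξ z - laplacianWith hX (dzLog h) ξ.1.1 z =
      z ^ m * (laplacianWith hX.swap (dzLog (hn n).swap) (swapSection ξ).1.1 z⁻¹ -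
        laplacianWith hX.swap (dzLog h.swap) (swapSection ξ).1.1 z⁻¹) := by
    filter_upwards [ae_laplacianWith_dzLog_eq_swap hX hd ξ,
      ae_laplacianWith_dzLog_eq_swap hX (h := hn n) (Eventually.of_forall fun z =>
        (hns n).contDiff_logChart.differentiable (by simp) z) ξ] with z h1 h2 hz
    rw [laplacian_eq hX (hns n), h1 hz, h2 hz]
    ring
  rw [laplacian_eq hX (hns n)] at hS ⊢
  refine (eLpNorm_weight_le hX h
    (S' := fun w => laplacianWith hX.swap (dzLog (hn n).swap) (swapSection ξ).1.1 w -
        laplacianWith hX.swap (dzLog h.swap) (swapSection ξ).1.1 w)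
    ((measurable_laplacianWith hX (measurable_dzLog _) _).sub
      (measurable_laplacianWith hX (measurable_dzLog _) _))
    ((measurable_laplacianWith hX.swap (measurable_dzLog _) _).sub
      (measurable_laplacianWith hX.swap (measurable_dzLog _) _)) hS).trans ?_
  rw [mul_assoc, mul_assoc]
  exact add_le_add ((hC' _).trans (mul_le_mul_right (hA _ _) _))
    ((hD' _).trans (mul_le_mul_right (hB _ _) _))

/-! ### Density of smooth sections, and tensors -/

/-- The section of `O(m)` with a given compactly supported coefficient on the `z`-chart. -/
def compactlySupportedSection (m : ℤ) {g : ℂ → ℂ} (hg : ContDiff ℝ ∞ g)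
    (hc : HasCompactSupport g) : SmoothSection m :=
  ⟨(g, fun w => if w = 0 then 0 else w ^ m * g w⁻¹), hg, by
    rw [contDiff_iff_contDiffAt]
    intro w
    rcases eq_or_ne w 0 with rfl | hw
    -- Near infinity the section vanishes identically, because `w⁻¹` leaves the bounded support of
    -- `g`.
    · refine (contDiffAt_const (c := (0 : ℂ))).congr_of_eventuallyEq ?_
      obtain ⟨R, hR, hR'⟩ := hc.isCompact.isBounded.subset_closedBall_lt 0 0
      filter_upwards [Metric.ball_mem_nhds (0 : ℂ) (inv_pos.mpr hR)] with x hx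
      split_ifs with h0
      · rfl
      · suffices hx' : x⁻¹ ∉ tsupport g by rw [image_eq_zero_of_notMem_tsupport hx', mul_zero]
        intro hx'
        have h1 := hR' hx'
        rw [mem_closedBall_zero_iff, norm_inv] at h1
        rw [mem_ball_zero_iff] at hx
        exact absurd h1 (not_le.mpr ((lt_inv_comm₀ (norm_pos_iff.mpr h0) hR).mp hx))
    · have h1 : ContDiffAt ℝ ∞ (fun x : ℂ => x ^ m * g x⁻¹) w := by
        have h2 : ContDiffAt ℂ ∞ (fun x : ℂ => x ^ m) w :=
          (analyticAt_id.zpow hw).contDiffAt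
        have h3 : ContDiffAt ℂ ∞ (fun x : ℂ => x⁻¹) w := contDiffAt_inv ℂ hw
        exact (h2.restrict_scalars ℝ).mul (hg.contDiffAt.comp w (h3.restrict_scalars ℝ))
      refine h1.congr_of_eventuallyEq ?_
      filter_upwards [isOpen_ne.mem_nhds hw] with x hx
      rw [if_neg hx], fun z hz => by
    change g z = z ^ m * (if z⁻¹ = 0 then 0 else z⁻¹ ^ m * g z⁻¹⁻¹)
    rw [if_neg (inv_ne_zero hz), inv_inv, inv_zpow, mul_inv_cancel_left₀ (zpow_ne_zero m hz)]⟩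

/-- An element orthogonal to all smooth sections integrates to zero against every real test
function, hence vanishes. Square integrability alone therefore places a value in the completion. -/
theorem l2Completion_eq_top {m : ℤ} (hX : HermitianMetric 2) (h : HermitianMetric m) :
    L2Completion hX h = ⊤ := by
  have hlf : IsLocallyFiniteMeasure (weight hX h) :=
    IsLocallyFiniteMeasure.withDensity_ofReal
      ((hX.continuous₀.mul h.continuous₀).div_const Real.pi)
  rw [Submodule.topologicalClosure_eq_top_iff, Submodule.eq_bot_iff]
  intro f hf
  rw [Submodule.mem_orthogonal] at hf
  have hloc : LocallyIntegrable (f : ℂ → ℂ) (weight hX h) :=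
    (Lp.memLp f).locallyIntegrable one_le_two
  have hae : ∀ᵐ z ∂weight hX h, f z = 0 :=
      ae_eq_zero_of_integral_contDiff_smul_eq_zero hloc fun g hg hgc => by
    have hgc' : HasCompactSupport fun x => (g x : ℂ) :=
      hgc.comp_left (g := fun x : ℝ => (x : ℂ)) rfl
    have h1 := hf _ ⟨compactlySupportedSection m (contDiff_ofReal_comp hg) hgc', rfl⟩
    rw [L2.inner_def] at h1
    rw [← h1]
    refine integral_congr_ae ?_
    filter_upwards [(memLp_smoothSection hX h
      (compactlySupportedSection m (contDiff_ofReal_comp hg) hgc')).coeFn_toLp] with z hz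
    have hz' : (toL2 hX h (compactlySupportedSection m (contDiff_ofReal_comp hg) hgc') : ℂ → ℂ) z =
      (g z : ℂ) := hz
    rw [hz']
    simp [mul_comm]
  have hae' : (f : ℂ → ℂ) =ᵐ[weight hX h] 0 := hae
  exact Lp.ext (hae'.trans (Lp.coeFn_zero ℂ 2 (weight hX h)).symm)

/-- `σ` is holomorphic, so `∂̄` falls on `f` alone and `∂` then produces `∂σ/∂z`. -/
theorem laplacianWith_tensor {m : ℤ} (hX : HermitianMetric 2) (L : ℂ → ℂ) (f : SmoothSection 0)
    (σ : HolomorphicSection m) (z : ℂ) :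
    laplacianWith hX L (tensor f σ).1.1 z =
      -((hX.chart₀ z : ℂ)⁻¹ * (dz (dzbar f.1.1) z * σ.1.1 z)) -
        (hX.chart₀ z : ℂ)⁻¹ * ((deriv σ.1.1 z + L z * σ.1.1 z) * dzbar f.1.1 z) := by
  have hf : Differentiable ℝ f.1.1 := f.2.1.differentiable (by simp)
  have hf' : Differentiable ℝ (dzbar f.1.1) := (contDiff_dzbar f.2.1).differentiable (by simp)
  have hσ : ∀ x, HasWirtingerDerivAt σ.1.1 (deriv σ.1.1 x) 0 x := fun x =>
    HasDerivAt.hasWirtingerDerivAt (σ.2.1 x).hasDerivAt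
  have e : dzbar (tensor f σ).1.1 = fun x => dzbar f.1.1 x * σ.1.1 x := funext fun x => by
    have := ((hasWirtingerDerivAt_of_differentiableAt (hf x)).mul (hσ x)).dzbar_eq
    rw [mul_zero, add_zero] at this
    exact this
  rw [laplacianWith, e, ((hasWirtingerDerivAt_of_differentiableAt (hf' z)).mul (hσ z)).dz_eq]
  ring

theorem laplacianWith_tensor_ae_eq {m : ℤ} (hX : HermitianMetric 2) {h : HermitianMetric m}
    (hadm : h.IsAdmissible) (hinv : h.IsCircleInvariant) (f : SmoothSection 0)
    (σ : HolomorphicSection m) :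
    laplacianWith hX (dzLog h) (tensor f σ).1.1 =ᵐ[weight hX h] directLaplacian hX h f σ := by
  refine (weight_absolutelyContinuous hX h).ae_le ?_
  have h0 : ∀ᵐ x : ℂ, x ≠ 0 := by simp [ae_iff]
  filter_upwards [h0, ae_differentiableAt_logChart hadm hinv] with z hz hd
  rw [laplacianWith_tensor, directLaplacian, HermitianMetric.radialLogDeriv_eq_dz hinv hz hd]
  rfl

/-- The operator `Δ_{E,∞}`. -/
def limitLaplacian {m : ℤ} (hX : HermitianMetric 2) {h : HermitianMetric m}
    (hadm : h.IsAdmissible) (hinv : h.IsCircleInvariant) :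
    SmoothSection m →ₗ[ℂ] L2Completion hX h where
  toFun ξ := ⟨(memLp_laplacianWith hX hadm hinv ξ).toLp _,
    l2Completion_eq_top hX h ▸ Submodule.mem_top⟩
  map_add' ξ η := Subtype.ext <| by
    change _ = (memLp_laplacianWith hX hadm hinv ξ).toLp _ +
      (memLp_laplacianWith hX hadm hinv η).toLp _
    exact MemLp.toLp_congr (memLp_laplacianWith hX hadm hinv (ξ + η))
      ((memLp_laplacianWith hX hadm hinv ξ).add (memLp_laplacianWith hX hadm hinv η))
      (Eventually.of_forall fun z => laplacianWith_add hX _ ξ.2.1 η.2.1 z)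
  map_smul' c ξ := Subtype.ext <| by
    change _ = c • (memLp_laplacianWith hX hadm hinv ξ).toLp _
    exact MemLp.toLp_congr (memLp_laplacianWith hX hadm hinv (c • ξ))
      ((memLp_laplacianWith hX hadm hinv ξ).const_smul c) (Eventually.of_forall fun z =>
      laplacianWith_const_mul hX _ c ξ.2.1 z)

theorem coeFn_limitLaplacian {m : ℤ} (hX : HermitianMetric 2) {h : HermitianMetric m}
    (hadm : h.IsAdmissible) (hinv : h.IsCircleInvariant) (ξ : SmoothSection m) :
    ((limitLaplacian hX hadm hinv ξ : L2 hX h) : ℂ → ℂ) =ᵐ[weight hX h]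
      laplacianWith hX (dzLog h) ξ.1.1 :=
  (memLp_laplacianWith hX hadm hinv ξ).coeFn_toLp

theorem one_add_norm_pow_ne_zero (n : ℕ) (z : ℂ) : (1 + (z * conj z) ^ n : ℂ) ≠ 0 := by
  rw [Complex.mul_conj, ← Complex.ofReal_pow, ← Complex.ofReal_one, ← Complex.ofReal_add]
  have := Complex.normSq_nonneg z
  exact Complex.ofReal_ne_zero.mpr (by positivity)

theorem contDiff_div_one_add_norm_pow (n : ℕ) {s : ℂ → ℂ} (hs : ContDiff ℝ ∞ s) :
    ContDiff ℝ ∞ fun z => s z / (1 + (z * conj z) ^ n) := by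
  have h1 : ContDiff ℝ ∞ fun z : ℂ => 1 + (z * conj z) ^ n :=
    contDiff_const.add ((contDiff_id.mul Complex.conjCLE.contDiff).pow n)
  simp only [div_eq_mul_inv]
  exact hs.mul (h1.inv (one_add_norm_pow_ne_zero n))

theorem contDiff_conj_pow_mul (n : ℕ) {s : ℂ → ℂ} (hs : ContDiff ℝ ∞ s) :
    ContDiff ℝ ∞ fun z => conj z ^ n * s z :=
  (Complex.conjCLE.contDiff.pow n).mul hs

/-- For `n ≥ 0`, every smooth section of `O(n)` is a sum of two tensors. -/
theorem exists_eq_tensor_add_tensor {m : ℤ} (hm : 0 ≤ m) (ξ : SmoothSection m) :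
    ∃ (f g : SmoothSection 0) (σ τ : HolomorphicSection m), ξ = tensor f σ + tensor g τ := by
  obtain ⟨n, rfl⟩ := Int.eq_ofNat_of_zero_le hm
  obtain ⟨⟨s₀, s₁⟩, hs₀, hs₁, hs⟩ := ξ
  dsimp only at hs₀ hs₁ hs
  have hinv : ∀ z : ℂ, z ≠ 0 → (1 + (z⁻¹ * conj z⁻¹) ^ n : ℂ) =
      (1 + (z * conj z) ^ n) / (z ^ n * conj z ^ n) := fun z hz => by
    have hzb : conj z ≠ 0 := by simpa using hz
    have h1 : (z * conj z) ^ n ≠ 0 := pow_ne_zero n (mul_ne_zero hz hzb)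
    rw [map_inv₀, ← mul_inv, inv_pow, ← mul_pow, eq_div_iff h1, add_mul, inv_mul_cancel₀ h1,
      one_mul, add_comm]
  -- The holomorphic sections `1` and `z ^ n` have no common zero. Splitting `1` as `1 / (1 +
  -- |z|^{2n})` plus `|z|^{2n} / (1 + |z|^{2n})` lets the first part of `ξ` be divided by `1` and
  -- the second by `z ^ n`; the resulting quotients extend smoothly over infinity.
  refine ⟨⟨(fun z => s₀ z / (1 + (z * conj z) ^ n),
      fun w => conj w ^ n * (s₁ w / (1 + (w * conj w) ^ n))),
      contDiff_div_one_add_norm_pow n hs₀,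
      contDiff_conj_pow_mul n (contDiff_div_one_add_norm_pow n hs₁), fun z hz => ?_⟩,
    ⟨(fun z => conj z ^ n * (s₀ z / (1 + (z * conj z) ^ n)),
      fun w => s₁ w / (1 + (w * conj w) ^ n)),
      contDiff_conj_pow_mul n (contDiff_div_one_add_norm_pow n hs₀),
      contDiff_div_one_add_norm_pow n hs₁, fun z hz => ?_⟩,
    ⟨(fun _ => 1, fun w => w ^ n), differentiable_const _, differentiable_pow n,
      fun z hz => ?_⟩,
    ⟨(fun z => z ^ n, fun _ => 1), differentiable_pow n, differentiable_const _,
      fun z hz => ?_⟩, Subtype.ext (Prod.ext (funext fun z => ?_) (funext fun w => ?_))⟩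
  · have hzb : conj z ≠ 0 := by simpa using hz
    have h1 := one_add_norm_pow_ne_zero n z
    dsimp only
    rw [hs z hz, hinv z hz, zpow_natCast, zpow_zero, map_inv₀, inv_pow]
    field_simp
  · have hzb : conj z ≠ 0 := by simpa using hz
    have h1 := one_add_norm_pow_ne_zero n z
    dsimp only
    rw [hs z hz, hinv z hz, zpow_natCast, zpow_zero]
    field_simp
  · simp [hz]
  · simp
  · change s₀ z = s₀ z / (1 + (z * conj z) ^ n) * 1 +
      conj z ^ n * (s₀ z / (1 + (z * conj z) ^ n)) * z ^ n
    have h1 := one_add_norm_pow_ne_zero n z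
    field_simp
    ring
  · change s₁ w = conj w ^ n * (s₁ w / (1 + (w * conj w) ^ n)) * w ^ n +
      s₁ w / (1 + (w * conj w) ^ n) * 1
    have h1 := one_add_norm_pow_ne_zero n w
    field_simp
    ring

/-- The formula fixes the values on tensors almost everywhere, hence in `L²`, and for `m ≥ 0` these
span all smooth sections. -/
theorem isDirectLaplacian_iff {m : ℤ} (hX : HermitianMetric 2) {h : HermitianMetric m}
    (hadm : h.IsAdmissible) (hinv : h.IsCircleInvariant)
    (D : SmoothSection m →ₗ[ℂ] L2Completion hX h) :
    IsDirectLaplacian hX h D ↔ D = limitLaplacian hX hadm hinv := by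
  have key : IsDirectLaplacian hX h (limitLaplacian hX hadm hinv) := fun f σ =>
    (coeFn_limitLaplacian hX hadm hinv _).trans (laplacianWith_tensor_ae_eq hX hadm hinv f σ)
  refine ⟨fun H => LinearMap.ext fun ξ => ?_, fun H => H ▸ key⟩
  have ht : ∀ (f : SmoothSection 0) (σ : HolomorphicSection m),
      D (tensor f σ) = limitLaplacian hX hadm hinv (tensor f σ) := fun f σ =>
    Subtype.ext (Lp.ext ((H f σ).trans (key f σ).symm))
  obtain ⟨f, g, σ, τ, rfl⟩ :=
    exists_eq_tensor_add_tensor (HermitianMetric.degree_nonneg hadm hinv) ξ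
  rw [map_add, map_add, ht, ht]

theorem isLimitLaplacian_limitLaplacian {m : ℤ} (hX : HermitianMetric 2) {h : HermitianMetric m}
    (hadm : h.IsAdmissible) (hinv : h.IsCircleInvariant) :
    IsLimitLaplacian hX h (limitLaplacian hX hadm hinv) := by
  intro m₁ m₂ h₁ h₂ h₁n h₂n hn hq H₁ H₂ hqn ξ
  refine (tendsto_eLpNorm_laplacian_sub hX hadm hinv hq H₁ H₂ hqn ξ).congr fun n =>
    eLpNorm_congr_ae ?_
  filter_upwards [coeFn_limitLaplacian hX hadm hinv ξ] with z hz
  rw [hz]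

/-- Any approximating sequence of `h`, paired with the constant sequence on the trivial bundle, is
an admissible test; the same Laplacians then converge to both values. -/
theorem IsLimitLaplacian.unique {m : ℤ} {hX : HermitianMetric 2} {h : HermitianMetric m}
    (hadm : h.IsAdmissible) {D D' : SmoothSection m → L2Completion hX h}
    (H : IsLimitLaplacian hX h D) (H' : IsLimitLaplacian hX h D') (ξ : SmoothSection m) :
    D ξ = D' ξ := by
  obtain ⟨hn, Hn⟩ := hadm
  have t := H m 0 h HermitianMetric.trivial hn (fun _ => HermitianMetric.trivial) hn
    h.isQuotient_trivial Hn HermitianMetric.isPositiveApproximation_trivial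
    (fun n => (hn n).isQuotient_trivial) ξ
  have t' := H' m 0 h HermitianMetric.trivial hn (fun _ => HermitianMetric.trivial) hn
    h.isQuotient_trivial Hn HermitianMetric.isPositiveApproximation_trivial
    (fun n => (hn n).isQuotient_trivial) ξ
  have hsum := t'.add t
  rw [add_zero] at hsum
  have hle : ∀ n, eLpNorm (((D ξ : L2 hX h) : ℂ → ℂ) - ((D' ξ : L2 hX h) : ℂ → ℂ)) 2
      (weight hX h) ≤
      eLpNorm (fun z => laplacian hX (hn n) ξ z - (D' ξ : L2 hX h) z) 2 (weight hX h) +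
      eLpNorm (fun z => laplacian hX (hn n) ξ z - (D ξ : L2 hX h) z) 2 (weight hX h) := by
    intro n
    have hm : AEStronglyMeasurable (laplacian hX (hn n) ξ) (weight hX h) := by
      rw [laplacian_eq hX (Hn.1 n).1]
      exact (measurable_laplacianWith hX (measurable_dzLog _) _).aestronglyMeasurable
    refine le_trans (le_of_eq (congrArg (fun f => eLpNorm f 2 _) ?_)) (eLpNorm_sub_le
      (hm.sub (Lp.aestronglyMeasurable (D' ξ : L2 hX h)))
      (hm.sub (Lp.aestronglyMeasurable (D ξ : L2 hX h))) one_le_two)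
    funext z
    simp
  have h0 : edist (D ξ : L2 hX h) (D' ξ : L2 hX h) = 0 := by
    rw [Lp.edist_def]
    exact le_antisymm (ge_of_tendsto' hsum hle) zero_le
  exact Subtype.ext (edist_eq_zero.mp h0)

end P1

end

theorem mainTheorem10 (m : ℤ) (hX : P1.HermitianMetric 2) (h : P1.HermitianMetric m)
    (hadm : h.IsAdmissible) (hinv : h.IsCircleInvariant) :
    (ConcaveOn ℝ Set.univ h.logRadial ∧
      ∀ u : ℝ, DifferentiableWithinAt ℝ h.logRadial (Set.Ioi u) u) ∧
    (∀ (f : P1.SmoothSection 0) (σ : P1.HolomorphicSection m),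
      MeasureTheory.MemLp (P1.directLaplacian hX h f σ) 2 (P1.weight hX h)) ∧
    ∃ D : P1.SmoothSection m →ₗ[ℂ] P1.L2Completion hX h,
      (∀ D' : P1.SmoothSection m →ₗ[ℂ] P1.L2Completion hX h,
        P1.IsDirectLaplacian hX h D' ↔ D' = D) ∧
      (∀ D' : P1.SmoothSection m → P1.L2Completion hX h,
        P1.IsLimitLaplacian hX h D' ↔ ∀ ξ, D' ξ = D ξ) := by
  refine ⟨⟨P1.HermitianMetric.concaveOn_logRadial hadm hinv,
    P1.HermitianMetric.differentiableWithinAt_logRadial hadm hinv⟩, fun f σ => ?_,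
    P1.limitLaplacian hX hadm hinv, fun D' => P1.isDirectLaplacian_iff hX hadm hinv D',
    fun D' => ⟨fun H ξ => ?_, fun H => ?_⟩⟩
  · exact (P1.memLp_laplacianWith hX hadm hinv (P1.tensor f σ)).ae_eq
      (P1.laplacianWith_tensor_ae_eq hX hadm hinv f σ)
  · exact H.unique hadm (P1.isLimitLaplacian_limitLaplacian hX hadm hinv) ξ
  · rw [funext H]
    exact P1.isLimitLaplacian_limitLaplacian hX hadm hinv
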